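/- An arithmetic circuit over a field $\mathbb F$ in variables $x_1,\dots,x_n$ is a sequence of $s\ge 1$ gates, each of which is a variable, a constant of $\mathbb F$, or the sum or the product of two earlier gates, with a designated output gate; $s$ is its size. The problem $k$-MMD asks, given a circuit $C$ computing a polynomial $f\in\mathbb F[x_1,\dots,x_n]$ and a number $k\ge 0$, whether some multilinear monomial of degree $k$ has a nonzero coefficient in $f$. The machine model is a random access machine that works on natural numbers and on elements of $\mathbb F$: it can perform arithmetic and comparisons of natural numbers, the field operations and equality tests in $\mathbb F$, indexed reads and writes of arrays of natural numbers and of field elements, and fair coin tosses. Each elementary command and each test is one step. A run uses space at most $S$ if throughout the run only array cells with addresses below $S$ are in use and every stored natural number has at most $S$ bits (so that $O(S^2)$ bits and $O(S)$ field elements are stored, and a step costs $O(1)$ field operations and $S^{O(1)}$ bit operations). **Theorem.** There are a single randomized program $P$, which does not depend on the field, and a constant $c$ such that for every field $\mathbb F$, all $n,k\ge 0$, and every arithmetic circuit $C$ of size $s$ in $n$ variables over $\mathbb F$ computing $f$, the following holds for $P$ on input $(C,k)$. 1. For every outcome of the coin tosses, $P$ halts with answer $0$ or $1$ after at most $c\,(n+k+s)^{c}\cdot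 4.32^{k}$ steps, using space at most $c\,(n+k+s)^{c}$. 2. If $f$ has a multilinear monomial of degree $k$ with nonzero coefficient, then $P$ answers $1$ with probability at least $2/3$. 3. Otherwise $P$ answers $0$ for every outcome of the coin tosses. In particular, for circuits of size $\mathrm{poly}(n)$, $k$-MMD is solved by a randomized algorithm in time $O^*(4.32^k)=4.32^k\cdot\mathrm{poly}(n,k)$ and space $\mathrm{poly}(n,k)$. -/

import Mathlib

/-!
The model of computation is a random access machine with an algebraic part, programmed in a
structured language.  A state holds natural-number registers, finitely many natural-number arrays,
finitely many arrays of elements of a field `F` (those that the program text names), and a tape of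
unread random bits.  Programs mention no field, so one program runs over every field.
-/

namespace KMMD

/-- A gate of an arithmetic circuit in `n` variables over `F`, of fan-in at most two; its operands
are found among the `m` gates that precede it. -/
inductive Gate (F : Type*) (n m : ℕ) where
  | var (i : Fin n)
  | const (c : F)
  | add (a b : Fin m)
  | mul (a b : Fin m)

/-- An arithmetic circuit in the variables `x₀, …, x_{n-1}` over `F`: gates in topological order
and a designated output gate. -/
structure Circuit (F : Type*) (n : ℕ) where
  /-- the number of gates -/
  size : ℕ
  /-- gate number `p`, whose operands are gates with smaller numbers -/
  gate : (p : Fin size) → Gate F n p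
  /-- the output gate -/
  out : Fin size

section Polynomial

variable {F : Type*} [Field F] {n : ℕ}

/-- The polynomial computed at gate `p`. -/
noncomputable def Circuit.polyAt (C : Circuit F n) (p : Fin C.size) : MvPolynomial (Fin n) F :=
  match C.gate p with
  | .var i => MvPolynomial.X i
  | .const c => MvPolynomial.C c
  | .add a b => C.polyAt ⟨a, a.2.trans p.2⟩ + C.polyAt ⟨b, b.2.trans p.2⟩
  | .mul a b => C.polyAt ⟨a, a.2.trans p.2⟩ * C.polyAt ⟨b, b.2.trans p.2⟩
termination_by p.val
decreasing_by all_goals exact Fin.is_lt _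

/-- The polynomial computed by the circuit. -/
noncomputable def Circuit.poly (C : Circuit F n) : MvPolynomial (Fin n) F := C.polyAt C.out

/-- `f` has a multilinear monomial of degree `k` with nonzero coefficient. -/
def HasMultilinearMonomial (k : ℕ) (f : MvPolynomial (Fin n) F) : Prop :=
  ∃ m : Fin n →₀ ℕ, (∀ i, m i ≤ 1) ∧ m.degree = k ∧ MvPolynomial.coeff m f ≠ 0

end Polynomial

/-- States of the machine. -/
structure State (F : Type*) where
  /-- the natural-number registers -/
  reg : ℕ → ℕ
  /-- `arr a i` is cell `i` of natural-number array `a` -/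
  arr : ℕ → ℕ → ℕ
  /-- `farr a i` is cell `i` of field array `a` -/
  farr : ℕ → ℕ → F
  /-- the random bits not read so far -/
  coins : ℕ → Bool

/-- Natural-number expressions. -/
inductive NExp where
  | const (c : ℕ)
  | reg (x : ℕ)
  | get (a : ℕ) (i : NExp)
  | add (e₁ e₂ : NExp)
  | sub (e₁ e₂ : NExp)
  | mul (e₁ e₂ : NExp)
  | div (e₁ e₂ : NExp)
  | mod (e₁ e₂ : NExp)

/-- Field expressions: the field operations applied to `0`, `1` and array cells. -/
inductive FExp where
  | zero
  | one
  | get (a : ℕ) (i : NExp)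
  | add (e₁ e₂ : FExp)
  | sub (e₁ e₂ : FExp)
  | mul (e₁ e₂ : FExp)
  | inv (e : FExp)

/-- Tests.  The only test on field elements is equality. -/
inductive Test where
  | lt (e₁ e₂ : NExp)
  | eq (e₁ e₂ : NExp)
  | feq (e₁ e₂ : FExp)
  | not (b : Test)
  | and (b₁ b₂ : Test)

/-- Programs. -/
inductive Prog where
  /-- do nothing -/
  | skip
  /-- assign the value of `e` to register `x` -/
  | assign (x : ℕ) (e : NExp)
  /-- store the value of `e` in cell `i` of natural-number array `a` -/
  | store (a : ℕ) (i e : NExp)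
  /-- store the value of `e` in cell `i` of field array `a` -/
  | fstore (a : ℕ) (i : NExp) (e : FExp)
  /-- read the next random bit into register `x` -/
  | flip (x : ℕ)
  /-- sequential composition -/
  | seq (p q : Prog)
  /-- `if b then p else q` -/
  | cond (b : Test) (p q : Prog)
  /-- `while b do p` -/
  | loop (b : Test) (p : Prog)

section Semantics

variable {F : Type*}

/-- The value of a natural-number expression. -/
def NExp.eval (σ : State F) : NExp → ℕ
  | const c => c
  | reg x => σ.reg x
  | get a i => σ.arr a (i.eval σ)
  | add e₁ e₂ => e₁.eval σ + e₂.eval σ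
  | sub e₁ e₂ => e₁.eval σ - e₂.eval σ
  | mul e₁ e₂ => e₁.eval σ * e₂.eval σ
  | div e₁ e₂ => e₁.eval σ / e₂.eval σ
  | mod e₁ e₂ => e₁.eval σ % e₂.eval σ

/-- The value of a field expression. -/
def FExp.eval [Field F] (σ : State F) : FExp → F
  | zero => 0
  | one => 1
  | get a i => σ.farr a (i.eval σ)
  | add e₁ e₂ => e₁.eval σ + e₂.eval σ
  | sub e₁ e₂ => e₁.eval σ - e₂.eval σ
  | mul e₁ e₂ => e₁.eval σ * e₂.eval σ
  | inv e => (e.eval σ)⁻¹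

/-- The truth of a test. -/
def Test.Holds [Field F] (σ : State F) : Test → Prop
  | lt e₁ e₂ => e₁.eval σ < e₂.eval σ
  | eq e₁ e₂ => e₁.eval σ = e₂.eval σ
  | feq e₁ e₂ => e₁.eval σ = e₂.eval σ
  | not b => ¬ b.Holds σ
  | and b₁ b₂ => b₁.Holds σ ∧ b₂.Holds σ

/-- Update of register `x`. -/
def State.setReg (σ : State F) (x v : ℕ) : State F :=
  { σ with reg := Function.update σ.reg x v }

/-- Update of a cell of a natural-number array. -/
def State.setArr (σ : State F) (a i v : ℕ) : State F :=
  { σ with arr := Function.update σ.arr a (Function.update (σ.arr a) i v) }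

/-- Update of a cell of a field array. -/
def State.setFarr (σ : State F) (a i : ℕ) (v : F) : State F :=
  { σ with farr := Function.update σ.farr a (Function.update (σ.farr a) i v) }

/-- Moving the next random bit into register `x`. -/
def State.flipInto (σ : State F) (x : ℕ) : State F :=
  { σ with
    reg := Function.update σ.reg x (σ.coins 0).toNat
    coins := fun j => σ.coins (j + 1) }

/-- The state fits in space `S`: all natural numbers in it have at most `S` bits, and in every array
only cells with addresses below `S` are in use.  For a fixed program such a state
consists of `O(S²)` bits and `O(S)` field elements. -/
structure State.Fits [Zero F] (σ : State F) (S : ℕ) : Prop where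
  reg_lt : ∀ x, σ.reg x < 2 ^ S
  arr_lt : ∀ a i, σ.arr a i < 2 ^ S
  arr_eq : ∀ a i, S ≤ i → σ.arr a i = 0
  farr_eq : ∀ a i, S ≤ i → σ.farr a i = 0

/-- `Exec S p σ σ' t`: started in state `σ`, the program `p` halts in state `σ'` after `t` steps,
and every state reached on the way fits in space `S`.  Each elementary command and each
evaluation of a test is one step (its expressions have a size fixed by the program, and the natural
numbers in them have `O(S)` bits, so that a step amounts to `O(1)` field operations and a number of
bit operations polynomial in `S`). -/
inductive Exec [Field F] (S : ℕ) : Prog → State F → State F → ℕ → Prop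
  | skip (σ : State F) : Exec S .skip σ σ 1
  | assign (x : ℕ) (e : NExp) (σ : State F) :
      (σ.setReg x (e.eval σ)).Fits S → Exec S (.assign x e) σ (σ.setReg x (e.eval σ)) 1
  | store (a : ℕ) (i e : NExp) (σ : State F) :
      (σ.setArr a (i.eval σ) (e.eval σ)).Fits S →
      Exec S (.store a i e) σ (σ.setArr a (i.eval σ) (e.eval σ)) 1
  | fstore (a : ℕ) (i : NExp) (e : FExp) (σ : State F) :
      (σ.setFarr a (i.eval σ) (e.eval σ)).Fits S →
      Exec S (.fstore a i e) σ (σ.setFarr a (i.eval σ) (e.eval σ)) 1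
  | flip (x : ℕ) (σ : State F) :
      (σ.flipInto x).Fits S → Exec S (.flip x) σ (σ.flipInto x) 1
  | seq {p q : Prog} {σ σ₁ σ₂ : State F} {t₁ t₂ : ℕ} :
      Exec S p σ σ₁ t₁ → Exec S q σ₁ σ₂ t₂ → Exec S (.seq p q) σ σ₂ (t₁ + t₂)
  | cond_true {b : Test} {p q : Prog} {σ σ₁ : State F} {t : ℕ} :
      b.Holds σ → Exec S p σ σ₁ t → Exec S (.cond b p q) σ σ₁ (t + 1)
  | cond_false {b : Test} {p q : Prog} {σ σ₁ : State F} {t : ℕ} :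
      ¬ b.Holds σ → Exec S q σ σ₁ t → Exec S (.cond b p q) σ σ₁ (t + 1)
  | loop_false {b : Test} {p : Prog} {σ : State F} :
      ¬ b.Holds σ → Exec S (.loop b p) σ σ 1
  | loop_true {b : Test} {p : Prog} {σ σ₁ σ₂ : State F} {t₁ t₂ : ℕ} :
      b.Holds σ → Exec S p σ σ₁ t₁ → Exec S (.loop b p) σ₁ σ₂ t₂ →
      Exec S (.loop b p) σ σ₂ (t₁ + t₂ + 1)

/-- Started in `σ`, the program halts within time `T` and space `S`, with final answer `v` in
register `0`. -/
def Outputs [Field F] (P : Prog) (σ : State F) (T : ℝ) (S v : ℕ) : Prop :=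
  σ.Fits S ∧ ∃ (σ' : State F) (t : ℕ), Exec S P σ σ' t ∧ (t : ℝ) ≤ T ∧ σ'.reg 0 = v

end Semantics

section Input

variable {F : Type*} {n m : ℕ}

/-- The kind of a gate. -/
def Gate.code : Gate F n m → ℕ
  | var _ => 0
  | const _ => 1
  | add _ _ => 2
  | mul _ _ => 3

/-- The index of the variable, or of the left operand. -/
def Gate.left : Gate F n m → ℕ
  | var i => i
  | const _ => 0
  | add a _ => a
  | mul a _ => a

/-- The index of the right operand. -/
def Gate.right : Gate F n m → ℕ
  | var _ => 0
  | const _ => 0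
  | add _ b => b
  | mul _ b => b

/-- The field constant of the gate. -/
def Gate.scalar [Zero F] : Gate F n m → F
  | var _ => 0
  | const c => c
  | add _ _ => 0
  | mul _ _ => 0

/-- The initial state on input `(C, k)` with random bits `ω`: registers `0, 1, 2, 3` hold `n`, `k`,
the size and the output gate of `C`; natural-number arrays `0, 1, 2` hold the kinds, left
operands and right operands of the gates, field array `0` holds the constants; the rest is zero. -/
def initState [Field F] (C : Circuit F n) (k : ℕ) (ω : ℕ → Bool) : State F where
  reg x := match x with
    | 0 => n
    | 1 => k
    | 2 => C.size
    | 3 => C.out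
    | _ => 0
  arr a p := if h : p < C.size then
      match a with
      | 0 => (C.gate ⟨p, h⟩).code
      | 1 => (C.gate ⟨p, h⟩).left
      | 2 => (C.gate ⟨p, h⟩).right
      | _ => 0
    else 0
  farr a p := if h : p < C.size then
      match a with
      | 0 => (C.gate ⟨p, h⟩).scalar
      | _ => 0
    else 0
  coins := ω

end Input

/-- The law of an infinite sequence of independent fair coin tosses. -/
noncomputable def coinMeasure : MeasureTheory.Measure (ℕ → Bool) :=
  MeasureTheory.Measure.infinitePi fun _ : ℕ => (PMF.uniformOfFintype Bool).toMeasure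

end KMMD

/-! The algorithm combines random colouring, inclusion–exclusion over sets of colours and a random
univariate substitution. Put q = ⌊k/3⌋ + 1 and m = 4q, and colour every variable at random with one
of m colours. If U is the set of colours of a monomial, then the sum of (-1)^|T| C(|T|, m - k) over
all sets T ⊇ U is the coefficient of y^(m-k) in (-1)^m (1 + y)^|U| y^(m-|U|). As m is even and |U| ≤
k in degree k, this is 1 if |U| = k and 0 otherwise (`sum_weight`). Setting the variables with
colours outside T to zero keeps exactly the monomials with U ⊆ T. So in degree k the weighted sum of
these 2^m evaluations retains, with unchanged coefficients, the monomials with k different colours.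
They are multilinear, hence false positives are impossible, in every characteristic.

A surviving variable becomes X^(E + a) with a random a < A = 6q, where E = kA + 1. Only monomials of
degree k reach the exponents kE, …, kE + E - 1, so arithmetic modulo X^((k+1)E) suffices, and these
coefficients are those of the colourful part of f evaluated at the powers X^a (`sievedCoeff_eq`,
`hit_iff`). Schwartz–Zippel over the domain F[X], with A ≥ 2k powers of X as sample set, shows that
a nonzero colourful part survives with probability at least 1/2, however small F is
(`card_nonzero_ge`).

The variables of a fixed multilinear monomial of degree k get different colours with probability at
least (4q)!/(q! (4q)^(3q)) ≥ 1/(3q · 5.03^q), by Stirling and e³/4 < 5.03 (`descFactorial_ge`).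
Another factor 1/2 pays for the bias of reducing random bits modulo mA. Hence 24q(⌊5.03^q⌋ + 1)
independent trials fail with probability at most e⁻² < 1/3. A trial costs 2^(4q) times a polynomial,
and 16 · 5.03 = 80.48 < 4.32³; asymptotically the base is 2^(2/3) e, against 2e for m = k.

On the machine side, `Runs` is a total-correctness triple with a time bound, and `runs_detect` shows
that the answer is 1 exactly when some trial hits. What remains is combinatorics of trials. -/

/-! ### Reasoning about runs of programs -/

namespace KMMD

/-- The registers that a program may write. -/
def Prog.regs : Prog → List ℕ
  | .assign x _ => [x]
  | .flip x => [x]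
  | .seq p q => p.regs ++ q.regs
  | .cond _ p q => p.regs ++ q.regs
  | .loop _ p => p.regs
  | _ => []

/-- The natural-number arrays that a program may write. -/
def Prog.arrs : Prog → List ℕ
  | .store a _ _ => [a]
  | .seq p q => p.arrs ++ q.arrs
  | .cond _ p q => p.arrs ++ q.arrs
  | .loop _ p => p.arrs
  | _ => []

/-- The field arrays that a program may write. -/
def Prog.farrs : Prog → List ℕ
  | .fstore a _ _ => [a]
  | .seq p q => p.farrs ++ q.farrs
  | .cond _ p q => p.farrs ++ q.farrs
  | .loop _ p => p.farrs
  | _ => []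

/-- Whether a program may toss coins. -/
def Prog.flips : Prog → Bool
  | .flip _ => true
  | .seq p q => p.flips || q.flips
  | .cond _ p q => p.flips || q.flips
  | .loop _ p => p.flips
  | _ => false

/-- `σ'` differs from `σ` only in the parts of the state that `p` may write. -/
structure Frame {F : Type*} (p : Prog) (σ σ' : State F) : Prop where
  reg : ∀ x, x ∉ p.regs → σ'.reg x = σ.reg x
  arr : ∀ a, a ∉ p.arrs → σ'.arr a = σ.arr a
  farr : ∀ a, a ∉ p.farrs → σ'.farr a = σ.farr a
  coins : p.flips = false → σ'.coins = σ.coins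

section

variable {F : Type*}

theorem Frame.refl (p : Prog) (σ : State F) : Frame p σ σ :=
  ⟨fun _ _ => rfl, fun _ _ => rfl, fun _ _ => rfl, fun _ => rfl⟩

theorem Frame.trans {p : Prog} {σ₁ σ₂ σ₃ : State F} (h : Frame p σ₁ σ₂) (h' : Frame p σ₂ σ₃) :
    Frame p σ₁ σ₃ :=
  ⟨fun x hx => (h'.reg x hx).trans (h.reg x hx), fun x hx => (h'.arr x hx).trans (h.arr x hx),
    fun x hx => (h'.farr x hx).trans (h.farr x hx), fun hx => (h'.coins hx).trans (h.coins hx)⟩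

theorem Frame.mono {p q : Prog} {σ σ' : State F} (h : Frame p σ σ') (hr : p.regs ⊆ q.regs)
    (ha : p.arrs ⊆ q.arrs) (hf : p.farrs ⊆ q.farrs) (hc : q.flips = false → p.flips = false) :
    Frame q σ σ' :=
  ⟨fun x hx => h.reg x fun h' => hx (hr h'), fun x hx => h.arr x fun h' => hx (ha h'),
    fun x hx => h.farr x fun h' => hx (hf h'), fun hx => h.coins (hc hx)⟩

theorem Frame.seq_left {p q : Prog} {σ σ' : State F} (h : Frame p σ σ') :
    Frame (.seq p q) σ σ' :=
  h.mono (by simp [Prog.regs]) (by simp [Prog.arrs]) (by simp [Prog.farrs])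
    (by simp +contextual [Prog.flips])

theorem Frame.seq_right {p q : Prog} {σ σ' : State F} (h : Frame q σ σ') :
    Frame (.seq p q) σ σ' :=
  h.mono (by simp [Prog.regs]) (by simp [Prog.arrs]) (by simp [Prog.farrs])
    (by simp +contextual [Prog.flips])

theorem Frame.assign (x : ℕ) (e : NExp) (σ : State F) (v : ℕ) :
    Frame (.assign x e) σ (σ.setReg x v) := by
  refine ⟨fun y hy => ?_, fun _ _ => rfl, fun _ _ => rfl, fun _ => rfl⟩
  simp only [Prog.regs, List.mem_singleton] at hy
  simp [State.setReg, Function.update_of_ne hy]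

/-! Simplification rules for updated states. -/

section Updates

variable (σ : State F) (x y a b i j v : ℕ) (w : F)

@[simp] theorem State.setReg_reg : (σ.setReg x v).reg y = if y = x then v else σ.reg y := by
  simp [State.setReg, Function.update_apply]
@[simp] theorem State.setReg_arr : (σ.setReg x v).arr = σ.arr := rfl
@[simp] theorem State.setReg_farr : (σ.setReg x v).farr = σ.farr := rfl
@[simp] theorem State.setReg_coins : (σ.setReg x v).coins = σ.coins := rfl
@[simp] theorem State.setArr_reg : (σ.setArr a i v).reg = σ.reg := rfl
@[simp] theorem State.setArr_arr : (σ.setArr a i v).arr b j =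
    if b = a ∧ j = i then v else σ.arr b j := by
  by_cases hb : b = a
  · subst hb; simp [State.setArr, Function.update_apply]
  · simp [State.setArr, hb]
@[simp] theorem State.setArr_farr : (σ.setArr a i v).farr = σ.farr := rfl
@[simp] theorem State.setArr_coins : (σ.setArr a i v).coins = σ.coins := rfl
@[simp] theorem State.setFarr_reg : (σ.setFarr a i w).reg = σ.reg := rfl
@[simp] theorem State.setFarr_arr : (σ.setFarr a i w).arr = σ.arr := rfl
@[simp] theorem State.setFarr_farr : (σ.setFarr a i w).farr b j =
    if b = a ∧ j = i then w else σ.farr b j := by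
  by_cases hb : b = a
  · subst hb; simp [State.setFarr, Function.update_apply]
  · simp [State.setFarr, hb]
@[simp] theorem State.setFarr_coins : (σ.setFarr a i w).coins = σ.coins := rfl
@[simp] theorem State.flipInto_reg : (σ.flipInto x).reg y =
    if y = x then (σ.coins 0).toNat else σ.reg y := by
  simp [State.flipInto, Function.update_apply]
@[simp] theorem State.flipInto_arr : (σ.flipInto x).arr = σ.arr := rfl
@[simp] theorem State.flipInto_farr : (σ.flipInto x).farr = σ.farr := rfl
@[simp] theorem State.flipInto_coins : (σ.flipInto x).coins = fun j => σ.coins (j + 1) := rfl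

end Updates

variable [Field F] {S : ℕ}

/-- The write sets are computed from the program text, so later claims that a piece of code
preserves a register or an array are closed by `decide`. -/
theorem Exec.frame {p : Prog} {σ σ' : State F} {t : ℕ} (h : Exec S p σ σ' t) :
    Frame p σ σ' := by
  induction h with
  | skip σ => exact Frame.refl _ _
  | assign x e σ _ => exact Frame.assign x e σ _
  | store a i e σ _ =>
    refine ⟨fun _ _ => rfl, fun y hy => ?_, fun _ _ => rfl, fun _ => rfl⟩
    simp only [Prog.arrs, List.mem_singleton] at hy
    simp [State.setArr, Function.update_of_ne hy]
  | fstore a i e σ _ =>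
    refine ⟨fun _ _ => rfl, fun _ _ => rfl, fun y hy => ?_, fun _ => rfl⟩
    simp only [Prog.farrs, List.mem_singleton] at hy
    simp [State.setFarr, Function.update_of_ne hy]
  | flip x σ _ =>
    refine ⟨fun y hy => ?_, fun _ _ => rfl, fun _ _ => rfl, fun h => by simp [Prog.flips] at h⟩
    simp only [Prog.regs, List.mem_singleton] at hy
    simp [State.flipInto, Function.update_of_ne hy]
  | seq _ _ h₁ h₂ => exact h₁.seq_left.trans h₂.seq_right
  | cond_true _ _ h =>
    exact h.mono (by simp [Prog.regs]) (by simp [Prog.arrs]) (by simp [Prog.farrs])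
      (by simp +contextual [Prog.flips])
  | cond_false _ _ h =>
    exact h.mono (by simp [Prog.regs]) (by simp [Prog.arrs]) (by simp [Prog.farrs])
      (by simp +contextual [Prog.flips])
  | loop_false _ => exact Frame.refl _ _
  | loop_true _ _ _ h₁ h₂ => exact Frame.trans ⟨h₁.reg, h₁.arr, h₁.farr, h₁.coins⟩ h₂

theorem Exec.fits {p : Prog} {σ σ' : State F} {t : ℕ} (h : Exec S p σ σ' t) (hσ : σ.Fits S) :
    σ'.Fits S := by
  induction h with
  | skip σ => exact hσ
  | assign x e σ h => exact h
  | store a i e σ h => exact h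
  | fstore a i e σ h => exact h
  | flip x σ h => exact h
  | seq _ _ h₁ h₂ => exact h₂ (h₁ hσ)
  | cond_true _ _ h => exact h hσ
  | cond_false _ _ h => exact h hσ
  | loop_false _ => exact hσ
  | loop_true _ _ _ h₁ h₂ => exact h₂ (h₁ hσ)

theorem State.Fits.setReg {σ : State F} (h : σ.Fits S) {x v : ℕ} (hv : v < 2 ^ S) :
    (σ.setReg x v).Fits S := by
  refine ⟨fun y => ?_, h.arr_lt, h.arr_eq, h.farr_eq⟩
  by_cases hy : y = x
  · subst hy; simpa [State.setReg] using hv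
  · simpa [State.setReg, Function.update_of_ne hy] using h.reg_lt y

theorem State.Fits.setArr {σ : State F} (h : σ.Fits S) {a i v : ℕ} (hi : i < S) (hv : v < 2 ^ S) :
    (σ.setArr a i v).Fits S := by
  refine ⟨h.reg_lt, fun b j => ?_, fun b j hj => ?_, h.farr_eq⟩ <;>
    by_cases hb : b = a
  · subst hb
    by_cases hj : j = i
    · subst hj; simpa [State.setArr] using hv
    · simpa [State.setArr, Function.update_of_ne hj] using h.arr_lt b j
  · simpa [State.setArr, Function.update_of_ne hb] using h.arr_lt b j
  · subst hb
    simpa [State.setArr, Function.update_of_ne (show j ≠ i by omega)] using h.arr_eq b j hj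
  · simpa [State.setArr, Function.update_of_ne hb] using h.arr_eq b j hj

theorem State.Fits.setFarr {σ : State F} (h : σ.Fits S) {a i : ℕ} {v : F} (hi : i < S) :
    (σ.setFarr a i v).Fits S := by
  refine ⟨h.reg_lt, h.arr_lt, h.arr_eq, fun b j hj => ?_⟩
  by_cases hb : b = a
  · subst hb
    simpa [State.setFarr, Function.update_of_ne (show j ≠ i by omega)] using h.farr_eq b j hj
  · simpa [State.setFarr, Function.update_of_ne hb] using h.farr_eq b j hj

theorem State.Fits.flipInto {σ : State F} (h : σ.Fits S) {x : ℕ} (hS : 0 < S) :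
    (σ.flipInto x).Fits S := by
  refine ⟨fun y => ?_, h.arr_lt, h.arr_eq, h.farr_eq⟩
  by_cases hy : y = x
  · subst hy
    have h2 : 2 ≤ 2 ^ S := Nat.le_self_pow hS.ne' 2
    have := Bool.toNat_le (σ.coins 0)
    simp [State.flipInto]
    omega
  · simpa [State.flipInto, Function.update_of_ne hy] using h.reg_lt y

/-- Started in `σ`, the program `p` halts in space `S` after at most `t` steps, in a state that
satisfies `Q`. -/
def Runs (S : ℕ) (p : Prog) (σ : State F) (t : ℕ) (Q : State F → Prop) : Prop :=
  ∃ (σ' : State F) (t' : ℕ), Exec S p σ σ' t' ∧ t' ≤ t ∧ Q σ'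

/-! ### Proof rules for time- and space-bounded runs -/

namespace Runs

variable {p q : Prog} {σ : State F} {t t₁ t₂ : ℕ} {Q Q₁ : State F → Prop}

theorem weaken (h : Runs S p σ t₁ Q₁) (ht : t₁ ≤ t) (hQ : ∀ σ', Q₁ σ' → Q σ') :
    Runs S p σ t Q := by
  obtain ⟨σ', t', h1, h2, h3⟩ := h
  exact ⟨σ', t', h1, h2.trans ht, hQ _ h3⟩

theorem with_frame (h : Runs S p σ t Q) (hf : σ.Fits S) :
    Runs S p σ t fun σ' => Q σ' ∧ σ'.Fits S ∧ Frame p σ σ' := by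
  obtain ⟨σ', t', h1, h2, h3⟩ := h
  exact ⟨σ', t', h1, h2, h3, h1.fits hf, h1.frame⟩

theorem seq (h₁ : Runs S p σ t₁ Q₁) (hf : σ.Fits S)
    (h₂ : ∀ σ', σ'.Fits S → Frame p σ σ' → Q₁ σ' → Runs S q σ' t₂ Q) :
    Runs S (.seq p q) σ (t₁ + t₂) Q := by
  obtain ⟨σ₁, t, e₁, l₁, q₁⟩ := h₁
  obtain ⟨σ₂, t', e₂, l₂, q₂⟩ := h₂ σ₁ (e₁.fits hf) e₁.frame q₁
  exact ⟨σ₂, _, e₁.seq e₂, by omega, q₂⟩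

theorem skip (h : Q σ) : Runs S .skip σ 1 Q := ⟨σ, 1, .skip σ, le_rfl, h⟩

theorem assign {x : ℕ} {e : NExp} (hf : σ.Fits S) (v : ℕ) (he : e.eval σ = v) (hv : v < 2 ^ S)
    (h : Q (σ.setReg x v)) : Runs S (.assign x e) σ 1 Q := by
  subst he
  exact ⟨_, 1, .assign x e σ (hf.setReg hv), le_rfl, h⟩

theorem assign_seq {x : ℕ} {e : NExp} (hf : σ.Fits S) (v : ℕ) (he : e.eval σ = v)
    (hv : v < 2 ^ S) (h : (σ.setReg x v).Fits S → Runs S q (σ.setReg x v) t Q) :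
    Runs S (.seq (.assign x e) q) σ (t + 1) Q := by
  subst he
  obtain ⟨σ', t', e₁, l₁, q₁⟩ := h (hf.setReg hv)
  exact ⟨σ', _, (Exec.assign x e σ (hf.setReg hv)).seq e₁, by omega, q₁⟩

theorem store {a : ℕ} {i e : NExp} (hf : σ.Fits S) (j v : ℕ) (hi : i.eval σ = j)
    (he : e.eval σ = v) (hj : j < S) (hv : v < 2 ^ S) (h : Q (σ.setArr a j v)) :
    Runs S (.store a i e) σ 1 Q := by
  subst hi he
  exact ⟨_, 1, .store a i e σ (hf.setArr hj hv), le_rfl, h⟩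

theorem fstore {a : ℕ} {i : NExp} {e : FExp} (hf : σ.Fits S) (j : ℕ) (v : F)
    (hi : i.eval σ = j) (he : e.eval σ = v) (hj : j < S) (h : Q (σ.setFarr a j v)) :
    Runs S (.fstore a i e) σ 1 Q := by
  subst hi he
  exact ⟨_, 1, .fstore a i e σ (hf.setFarr hj), le_rfl, h⟩

theorem flip {x : ℕ} (hf : σ.Fits S) (hS : 0 < S) (h : Q (σ.flipInto x)) :
    Runs S (.flip x) σ 1 Q := ⟨_, 1, .flip x σ (hf.flipInto hS), le_rfl, h⟩

theorem cond {b : Test} (h₁ : b.Holds σ → Runs S p σ t Q) (h₂ : ¬ b.Holds σ → Runs S q σ t Q) :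
    Runs S (.cond b p q) σ (t + 1) Q := by
  by_cases hb : b.Holds σ
  · obtain ⟨σ', t', e, l, hq⟩ := h₁ hb
    exact ⟨σ', _, .cond_true hb e, by omega, hq⟩
  · obtain ⟨σ', t', e, l, hq⟩ := h₂ hb
    exact ⟨σ', _, .cond_false hb e, by omega, hq⟩

end Runs

/-- `for x from 0 to y - 1 do p`, where `y` is a register. -/
def Prog.forTo (x y : ℕ) (p : Prog) : Prog :=
  .seq (.assign x (.const 0))
    (.loop (.lt (.reg x) (.reg y)) (.seq p (.assign x (.add (.reg x) (.const 1)))))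

/-- A round costs the body, the increment and one test; the initialisation and the last, failing
test account for the final `+ 2`. By `hI` the invariant ignores the counter, so the increment
preserves it. -/
theorem Runs.forTo {x y : ℕ} {p : Prog} {σ : State F} {N t : ℕ} (I : ℕ → State F → Prop)
    (hf : σ.Fits S) (hN : σ.reg y = N) (hxy : y ≠ x) (hx : x ∉ p.regs) (hy : y ∉ p.regs)
    (hI : ∀ i σ' v, I i σ' → I i (σ'.setReg x v)) (h0 : I 0 σ)
    (hstep : ∀ i < N, ∀ σ', σ'.Fits S → Frame (Prog.forTo x y p) σ σ' → σ'.reg x = i → I i σ' →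
      Runs S p σ' t (I (i + 1))) :
    Runs S (Prog.forTo x y p) σ (N * (t + 2) + 2) (I N) := by
  have hNS : N < 2 ^ S := hN ▸ hf.reg_lt y
  have hregs : (Prog.forTo x y p).regs = x :: (p.regs ++ [x]) := by
    simp [Prog.forTo, Prog.regs]
  -- Induction on the number `d` of remaining rounds, from an arbitrary state at the loop head.
  have key : ∀ d i, i + d = N → ∀ σ', σ'.Fits S → Frame (Prog.forTo x y p) σ σ' →
      σ'.reg x = i → I i σ' →
      Runs S (.loop (.lt (.reg x) (.reg y)) (.seq p (.assign x (.add (.reg x) (.const 1)))))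
        σ' (d * (t + 2) + 1) (I N) := by
    intro d
    induction d with
    | zero =>
      intro i hi σ' hf' fr hxi hIi
      have hyN : σ'.reg y = N := by
        rw [fr.reg y (by simp [hregs, hxy, hy]), hN]
      refine ⟨σ', 1, .loop_false ?_, by omega, ?_⟩
      · simp only [Test.Holds, NExp.eval]; omega
      · have : i = N := by omega
        exact this ▸ hIi
    | succ d ih =>
      intro i hi σ' hf' fr hxi hIi
      have hyN : σ'.reg y = N := by
        rw [fr.reg y (by simp [hregs, hxy, hy]), hN]
      obtain ⟨σ₁, t₁, e₁, l₁, q₁⟩ := hstep i (by omega) σ' hf' fr hxi hIi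
      have hx₁ : σ₁.reg x = i := by rw [e₁.frame.reg x hx, hxi]
      have hf₁ := e₁.fits hf'
      have hf₂ : (σ₁.setReg x (i + 1)).Fits S := hf₁.setReg (by omega)
      have e₂ : Exec S (.assign x (.add (.reg x) (.const 1))) σ₁ (σ₁.setReg x (i + 1)) 1 := by
        have := Exec.assign (S := S) x (.add (.reg x) (.const 1)) σ₁
        simp only [NExp.eval, hx₁] at this
        exact this hf₂
      have fr₂ : Frame (Prog.forTo x y p) σ (σ₁.setReg x (i + 1)) := by
        refine fr.trans (Frame.seq_right ?_)
        have := (e₁.seq e₂).frame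
        exact ⟨this.reg, this.arr, this.farr, this.coins⟩
      obtain ⟨σ₃, t₃, e₃, l₃, q₃⟩ := ih (i + 1) (by omega) _ hf₂ fr₂ (by simp [State.setReg])
        (hI _ _ _ q₁)
      refine ⟨σ₃, _, .loop_true ?_ (e₁.seq e₂) e₃, ?_, q₃⟩
      · simp only [Test.Holds, NExp.eval]; omega
      · rw [Nat.succ_mul]; omega
  have hf0 : (σ.setReg x 0).Fits S := hf.setReg (by positivity)
  obtain ⟨σ', t', e, l, hq⟩ := key N 0 (by omega) (σ.setReg x 0) hf0
    (Frame.assign x _ σ 0).seq_left (by simp [State.setReg]) (hI _ _ _ h0)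
  exact ⟨σ', _, Exec.seq (.assign x (.const 0) σ hf0) e, by omega, hq⟩

end

end KMMD

/-! ### The program -/

namespace KMMD

/-- A third of `k`, rounded up strictly; four colours are used for each such block. -/
def blockCount (k : ℕ) : ℕ := k / 3 + 1

/-- The number of colours. -/
def colourCount (k : ℕ) : ℕ := 4 * blockCount k

/-- The number of exponents from which the evaluation points are drawn. -/
def exponentCount (k : ℕ) : ℕ := 6 * blockCount k

/-- The number of pairs of a colour and an exponent. -/
def pairCount (k : ℕ) : ℕ := colourCount k * exponentCount k

/-- The number of coins tossed for a variable. -/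
def bitCount (n k : ℕ) : ℕ := n + pairCount k

/-- The exponent that marks the degree of a monomial. -/
def shift (k : ℕ) : ℕ := k * exponentCount k + 1

/-- Univariate polynomials are computed modulo this power of the variable. -/
def truncation (k : ℕ) : ℕ := (k + 1) * shift k

/-- The number of independent trials. -/
def trialCount (k : ℕ) : ℕ :=
  24 * blockCount k * (503 ^ blockCount k / 100 ^ blockCount k + 1)

namespace Prog

/-- Draw a colour and an exponent for every variable. -/
def sample : Prog :=
  .forTo 22 0 <|
    .seq (.assign 24 (.const 0)) <|
    .seq (.forTo 23 7 <|
      .seq (.flip 25) <|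
      .assign 24 (.add (.reg 24) (.mul (.reg 25) (.get 3 (.reg 23))))) <|
    .seq (.store 4 (.reg 22) (.mod (.mod (.reg 24) (.reg 6)) (.reg 5))) <|
    .store 5 (.reg 22) (.div (.mod (.reg 24) (.reg 6)) (.reg 5))

/-- Clear the accumulator. -/
def clear : Prog := .forTo 26 8 (.fstore 3 (.reg 26) .zero)

/-- Count the colours in the current set. -/
def popcount : Prog :=
  .seq (.assign 29 (.const 0)) <|
  .forTo 28 5 <|
    .assign 29 (.add (.reg 29) (.mod (.div (.reg 27) (.get 3 (.reg 28))) (.const 2)))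

/-- One coefficient of the product of two gates. -/
def convolve : Prog :=
  .seq (.fstore 2 (.reg 30) .zero) <|
  .seq (.assign 33 (.add (.reg 32) (.const 1))) <|
  .forTo 34 33 <|
    .fstore 2 (.reg 30) <|
      .add (.get 2 (.reg 30)) <|
        .mul (.get 2 (.add (.mul (.get 1 (.reg 31)) (.reg 9)) (.reg 34)))
          (.get 2 (.add (.mul (.get 2 (.reg 31)) (.reg 9)) (.sub (.reg 32) (.reg 34))))

/-- One coefficient of a variable. -/
def substitute : Prog :=
  .cond (.and
      (.eq (.mod (.div (.reg 27) (.get 3 (.get 4 (.get 1 (.reg 31))))) (.const 2)) (.const 1))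
      (.eq (.reg 32) (.add (.reg 8) (.get 5 (.get 1 (.reg 31))))))
    (.fstore 2 (.reg 30) .one) (.fstore 2 (.reg 30) .zero)

/-- One coefficient of a constant. -/
def constant : Prog :=
  .cond (.eq (.reg 32) (.const 0)) (.fstore 2 (.reg 30) (.get 0 (.reg 31)))
    (.fstore 2 (.reg 30) .zero)

/-- One coefficient of the sum of two gates. -/
def addition : Prog :=
  .fstore 2 (.reg 30) <|
    .add (.get 2 (.add (.mul (.get 1 (.reg 31)) (.reg 9)) (.reg 32)))
      (.get 2 (.add (.mul (.get 2 (.reg 31)) (.reg 9)) (.reg 32)))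

/-- Evaluate all gates of the circuit. -/
def evaluate : Prog :=
  .forTo 30 13 <|
    .seq (.assign 31 (.div (.reg 30) (.reg 9))) <|
    .seq (.assign 32 (.mod (.reg 30) (.reg 9))) <|
    .cond (.eq (.get 0 (.reg 31)) (.const 0)) substitute <|
    .cond (.eq (.get 0 (.reg 31)) (.const 1)) constant <|
    .cond (.eq (.get 0 (.reg 31)) (.const 2)) addition convolve

/-- The field expression for the weighted contribution of the current set of colours. -/
def contribution : FExp :=
  .mul (.get 1 (.add (.mul (.reg 29) (.add (.reg 5) (.const 1))) (.reg 10)))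
    (.get 2 (.add (.mul (.reg 3) (.reg 9)) (.add (.mul (.reg 1) (.reg 8)) (.reg 35))))

/-- Add the contribution of the current set of colours to the accumulator. -/
def accumulate : Prog :=
  .forTo 35 8 <|
    .cond (.eq (.mod (.reg 29) (.const 2)) (.const 0))
      (.fstore 3 (.reg 35) (.add (.get 3 (.reg 35)) contribution))
      (.fstore 3 (.reg 35) (.sub (.get 3 (.reg 35)) contribution))

/-- Sum over all sets of colours. -/
def sumSets : Prog := .forTo 27 12 (.seq popcount (.seq evaluate accumulate))

/-- Test whether the accumulator is nonzero. -/
def test : Prog :=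
  .forTo 36 8 (.cond (.not (.feq (.get 3 (.reg 36)) .zero)) (.assign 20 (.const 1)) .skip)

/-- All trials. -/
def trials : Prog := .forTo 21 11 (.seq sample (.seq clear (.seq sumSets test)))

/-- Compute the powers of two. -/
def powers : Prog :=
  .seq (.assign 37 (.const 1)) <|
  .forTo 38 14 (.seq (.store 3 (.reg 38) (.reg 37)) (.assign 37 (.add (.reg 37) (.reg 37))))

/-- Compute the number of trials. -/
def countTrials : Prog :=
  .seq (.assign 39 (.const 1)) <|
  .seq (.assign 40 (.const 1)) <|
  .seq (.forTo 41 4 (.seq (.assign 39 (.mul (.reg 39) (.const 503)))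
    (.assign 40 (.mul (.reg 40) (.const 100))))) <|
  .assign 11 (.mul (.mul (.const 24) (.reg 4)) (.add (.div (.reg 39) (.reg 40)) (.const 1)))

/-- Compute the binomial coefficients in the field. -/
def pascal : Prog :=
  .forTo 42 15 <|
    .cond (.eq (.mod (.reg 42) (.add (.reg 5) (.const 1))) (.const 0))
      (.fstore 1 (.reg 42) .one) <|
    .cond (.lt (.reg 42) (.add (.reg 5) (.const 1)))
      (.fstore 1 (.reg 42) .zero) <|
    .fstore 1 (.reg 42) <|
      .add (.get 1 (.sub (.sub (.reg 42) (.add (.reg 5) (.const 1))) (.const 1)))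
        (.get 1 (.sub (.reg 42) (.add (.reg 5) (.const 1))))

/-- Compute the parameters. -/
def parameters : Prog :=
  .seq (.assign 4 (.add (.div (.reg 1) (.const 3)) (.const 1))) <|
  .seq (.assign 5 (.mul (.const 4) (.reg 4))) <|
  .seq (.assign 6 (.mul (.reg 5) (.mul (.const 6) (.reg 4)))) <|
  .seq (.assign 7 (.add (.reg 0) (.reg 6))) <|
  .seq (.assign 8 (.add (.mul (.reg 1) (.mul (.const 6) (.reg 4))) (.const 1))) <|
  .seq (.assign 9 (.mul (.add (.reg 1) (.const 1)) (.reg 8))) <|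
  .seq (.assign 10 (.sub (.reg 5) (.reg 1))) <|
  .seq (.assign 13 (.mul (.reg 2) (.reg 9))) <|
  .seq (.assign 14 (.add (.reg 7) (.const 1))) <|
  .assign 15 (.mul (.add (.reg 5) (.const 1)) (.add (.reg 5) (.const 1)))

/-- The whole program. -/
def detect : Prog :=
  .seq parameters <|
  .seq powers <|
  .seq (.assign 12 (.get 3 (.reg 5))) <|
  .seq countTrials <|
  .seq pascal <|
  .seq trials <|
  .assign 0 (.reg 20)

end Prog

/-! ### What the program computes -/

open Polynomial

/-- The number drawn for variable `i`. -/
def draw (L : ℕ) (ω : ℕ → Bool) (i : ℕ) : ℕ :=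
  ∑ j ∈ Finset.range L, (ω (i * L + j)).toNat * 2 ^ j

/-- The number of elements below `m` of the set with binary code `T`. -/
def popcount (m T : ℕ) : ℕ := ∑ c ∈ Finset.range m, T / 2 ^ c % 2

theorem popcount_le (m T : ℕ) : popcount m T ≤ m := by
  refine (Finset.sum_le_sum (g := fun _ => 1) fun c _ => ?_).trans (by simp)
  omega

section

variable {F : Type*} [Field F] {n : ℕ}

/-- The evaluation point that belongs to the colours `col`, the exponents `ex` and the set of
colours with binary code `T`. -/
noncomputable def point (F : Type*) [Field F] (n E : ℕ) (col ex : ℕ → ℕ) (T : ℕ) (i : Fin n) :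
    F[X] :=
  if T / 2 ^ col i % 2 = 1 then X ^ (E + ex i) else 0

/-- The value of gate `p` at `z`. -/
noncomputable def Circuit.valueAt (C : Circuit F n) (z : Fin n → F[X]) (p : ℕ) : F[X] :=
  if h : p < C.size then MvPolynomial.aeval z (C.polyAt ⟨p, h⟩) else 0

/-- The weight of a set of `s` colours, where `b` is the number of unused colours. -/
def weight (F : Type*) [Field F] (b s : ℕ) : F := (-1) ^ s * (s.choose b : F)

/-- The coefficients that a trial computes. -/
noncomputable def sievedCoeff (k : ℕ) (f : MvPolynomial (Fin n) F) (col ex : ℕ → ℕ) (d : ℕ) : F :=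
  ∑ T ∈ Finset.range (2 ^ colourCount k),
    weight F (colourCount k - k) (popcount (colourCount k) T) *
      (MvPolynomial.aeval (point F n (shift k) col ex T) f).coeff (k * shift k + d)

/-- A trial succeeds. -/
def Hit (k : ℕ) (f : MvPolynomial (Fin n) F) (col ex : ℕ → ℕ) : Prop :=
  ∃ d < shift k, sievedCoeff k f col ex d ≠ 0

/-- The colours that come from the coin tosses `ω`. -/
def drawnColour (n k : ℕ) (ω : ℕ → Bool) (i : ℕ) : ℕ :=
  draw (bitCount n k) ω i % pairCount k % colourCount k

/-- The exponents that come from the coin tosses `ω`. -/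
def drawnExponent (n k : ℕ) (ω : ℕ → Bool) (i : ℕ) : ℕ :=
  draw (bitCount n k) ω i % pairCount k / colourCount k

/-- Trial number `τ` succeeds with the coin tosses `ω`. -/
def TrialHits (k : ℕ) (f : MvPolynomial (Fin n) F) (ω : ℕ → Bool) (τ : ℕ) : Prop :=
  Hit k f (drawnColour n k fun j => ω (j + τ * (n * bitCount n k)))
    (drawnExponent n k fun j => ω (j + τ * (n * bitCount n k)))

section Gates

variable (C : Circuit F n) (z : Fin n → F[X]) {p : ℕ} (h : p < C.size)

theorem Circuit.valueAt_var {i : Fin n} (hg : C.gate ⟨p, h⟩ = .var i) : C.valueAt z p = z i := by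
  rw [Circuit.valueAt, dif_pos h, Circuit.polyAt, hg]
  simp

theorem Circuit.valueAt_const {c : F} (hg : C.gate ⟨p, h⟩ = .const c) :
    C.valueAt z p = Polynomial.C c := by
  rw [Circuit.valueAt, dif_pos h, Circuit.polyAt, hg]
  simp

theorem Circuit.valueAt_add {a b : Fin p} (hg : C.gate ⟨p, h⟩ = .add a b) :
    C.valueAt z p = C.valueAt z a + C.valueAt z b := by
  rw [Circuit.valueAt, dif_pos h, Circuit.polyAt, hg]
  simp [Circuit.valueAt, a.2.trans h, b.2.trans h]

theorem Circuit.valueAt_mul {a b : Fin p} (hg : C.gate ⟨p, h⟩ = .mul a b) :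
    C.valueAt z p = C.valueAt z a * C.valueAt z b := by
  rw [Circuit.valueAt, dif_pos h, Circuit.polyAt, hg]
  simp [Circuit.valueAt, a.2.trans h, b.2.trans h]

end Gates

end

end KMMD

/-! ### Correctness of the parts of a trial -/

namespace KMMD

open Polynomial

variable {F : Type*} [Field F] {n : ℕ}

/-- An amount of space that suffices. -/
def spaceNeed (n k s : ℕ) : ℕ :=
  s * truncation k + (colourCount k + 1) * (colourCount k + 1) + bitCount n k +
    10 * blockCount k + 10

/-- The parameters have been computed. -/
structure Prepared (C : Circuit F n) (k : ℕ) (σ : State F) : Prop where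
  reg0 : σ.reg 0 = n
  reg1 : σ.reg 1 = k
  reg3 : σ.reg 3 = C.out
  reg5 : σ.reg 5 = colourCount k
  reg6 : σ.reg 6 = pairCount k
  reg7 : σ.reg 7 = bitCount n k
  reg8 : σ.reg 8 = shift k
  reg9 : σ.reg 9 = truncation k
  reg10 : σ.reg 10 = colourCount k - k
  reg11 : σ.reg 11 = trialCount k
  reg12 : σ.reg 12 = 2 ^ colourCount k
  reg13 : σ.reg 13 = C.size * truncation k
  codes : ∀ p (h : p < C.size), σ.arr 0 p = (C.gate ⟨p, h⟩).code
  lefts : ∀ p (h : p < C.size), σ.arr 1 p = (C.gate ⟨p, h⟩).left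
  rights : ∀ p (h : p < C.size), σ.arr 2 p = (C.gate ⟨p, h⟩).right
  scalars : ∀ p (h : p < C.size), σ.farr 0 p = (C.gate ⟨p, h⟩).scalar
  powers : ∀ j ≤ bitCount n k, σ.arr 3 j = 2 ^ j
  binomials : ∀ i < (colourCount k + 1) * (colourCount k + 1),
    σ.farr 1 i = ((i / (colourCount k + 1)).choose (i % (colourCount k + 1)) : ℕ)

/-- The storage layout is chosen for this: trials write only higher-numbered registers and arrays,
so the precomputed data persist. -/
theorem Prepared.of_frame {C : Circuit F n} {k : ℕ} {σ σ' : State F} {p : Prog}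
    (h : Prepared C k σ) (fr : Frame p σ σ') (h₁ : ∀ x < 16, x ∉ p.regs)
    (h₂ : ∀ a < 4, a ∉ p.arrs) (h₃ : ∀ a < 2, a ∉ p.farrs) : Prepared C k σ' := by
  have r : ∀ x < 16, σ'.reg x = σ.reg x := fun x hx => fr.reg x (h₁ x hx)
  have a : ∀ x < 4, σ'.arr x = σ.arr x := fun x hx => fr.arr x (h₂ x hx)
  have f : ∀ x < 2, σ'.farr x = σ.farr x := fun x hx => fr.farr x (h₃ x hx)
  constructor
  case reg0 => rw [r _ (by omega), h.reg0]
  case reg1 => rw [r _ (by omega), h.reg1]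
  case reg3 => rw [r _ (by omega), h.reg3]
  case reg5 => rw [r _ (by omega), h.reg5]
  case reg6 => rw [r _ (by omega), h.reg6]
  case reg7 => rw [r _ (by omega), h.reg7]
  case reg8 => rw [r _ (by omega), h.reg8]
  case reg9 => rw [r _ (by omega), h.reg9]
  case reg10 => rw [r _ (by omega), h.reg10]
  case reg11 => rw [r _ (by omega), h.reg11]
  case reg12 => rw [r _ (by omega), h.reg12]
  case reg13 => rw [r _ (by omega), h.reg13]
  case codes => intro p hp; rw [a _ (by omega), h.codes p hp]
  case lefts => intro p hp; rw [a _ (by omega), h.lefts p hp]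
  case rights => intro p hp; rw [a _ (by omega), h.rights p hp]
  case scalars => intro p hp; rw [f _ (by omega), h.scalars p hp]
  case powers => intro p hp; rw [a _ (by omega), h.powers p hp]
  case binomials => intro p hp; rw [f _ (by omega), h.binomials p hp]

section Parameters

variable (n k s : ℕ)

theorem blockCount_pos : 0 < blockCount k := by simp [blockCount]

theorem le_three_blockCount : k ≤ 3 * blockCount k := by unfold blockCount; omega

theorem colourCount_pos : 0 < colourCount k := by
  have := blockCount_pos k; unfold colourCount; omega

theorem le_colourCount : k ≤ colourCount k := by
  have := le_three_blockCount k; unfold colourCount; omega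

theorem exponentCount_pos : 0 < exponentCount k := by
  have := blockCount_pos k; unfold exponentCount; omega

theorem pairCount_pos : 0 < pairCount k := Nat.mul_pos (colourCount_pos k) (exponentCount_pos k)

theorem colourCount_le_bitCount : colourCount k ≤ bitCount n k := by
  have := Nat.le_mul_of_pos_right (colourCount k) (exponentCount_pos k)
  unfold bitCount pairCount; omega

theorem shift_pos : 0 < shift k := by simp [shift]

theorem shift_le_truncation : shift k ≤ truncation k :=
  Nat.le_mul_of_pos_left _ (by omega)

theorem truncation_pos : 0 < truncation k := (shift_pos k).trans_le (shift_le_truncation k)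

theorem drawnColour_lt (ω : ℕ → Bool) (i : ℕ) : drawnColour n k ω i < colourCount k :=
  Nat.mod_lt _ (colourCount_pos k)

theorem drawnExponent_lt (ω : ℕ → Bool) (i : ℕ) : drawnExponent n k ω i < exponentCount k := by
  rw [drawnExponent, Nat.div_lt_iff_lt_mul (colourCount_pos k), mul_comm]
  exact Nat.mod_lt _ (pairCount_pos k)

variable {n k s}

theorem truncation_le_mul {s : ℕ} (hs : 0 < s) : truncation k ≤ s * truncation k :=
  Nat.le_mul_of_pos_left _ hs

end Parameters

theorem Circuit.size_pos {K : Type*} {n : ℕ} (C : Circuit K n) : 0 < C.size := C.out.pos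

variable {C : Circuit F n} {k S : ℕ} {σ : State F}

theorem sum_range_lt_two_pow (b : ℕ → ℕ) (hb : ∀ j, b j ≤ 1) (i : ℕ) :
    ∑ j ∈ Finset.range i, b j * 2 ^ j < 2 ^ i := by
  induction i with
  | zero => simp
  | succ i ih =>
    rw [Finset.sum_range_succ, pow_succ]
    have := Nat.mul_le_mul_right (2 ^ i) (hb i)
    omega

theorem draw_partial_lt (ω : ℕ → Bool) (o i : ℕ) :
    ∑ j ∈ Finset.range i, (ω (o + j)).toNat * 2 ^ j < 2 ^ i :=
  sum_range_lt_two_pow _ (fun _ => Bool.toNat_le _) i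

/-- The tape position is tracked exactly: every trial consumes the same number of coins, so
different trials read disjoint blocks. -/
theorem runs_sample (hσ : σ.Fits S) (hP : Prepared C k σ) (hS : spaceNeed n k C.size ≤ S) :
    Runs S Prog.sample σ (n * ((bitCount n k * 4 + 5) + 2) + 2) fun σ' =>
      σ'.coins = (fun j => σ.coins (j + n * bitCount n k)) ∧
      ∀ i < n, σ'.arr 4 i = drawnColour n k σ.coins i ∧
        σ'.arr 5 i = drawnExponent n k σ.coins i := by
  have hLS : bitCount n k < S := by unfold spaceNeed at hS; omega
  have hnL : n ≤ bitCount n k := by unfold bitCount; omega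
  refine Runs.forTo (fun i σ' => σ'.coins = (fun j => σ.coins (j + i * bitCount n k)) ∧
      ∀ i' < i, σ'.arr 4 i' = drawnColour n k σ.coins i' ∧
        σ'.arr 5 i' = drawnExponent n k σ.coins i') hσ hP.reg0 (by decide) (by decide) (by decide)
    (fun _ _ _ h => h) (by simp) ?_
  intro i hi σ₁ hf₁ fr₁ hi₁ ⟨hc₁, ha₁⟩
  have hP₁ := hP.of_frame fr₁ (by decide) (by decide) (by decide)
  refine (Runs.assign_seq (t := (bitCount n k * (2 + 2) + 2) + (1 + 1)) hf₁ 0 rfl (by positivity)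
    fun hf₂ => ?_).weaken (by omega) fun _ h => h
  refine Runs.seq (Runs.forTo (fun j σ' =>
      σ'.coins = (fun l => σ.coins (l + (i * bitCount n k + j))) ∧
      σ'.reg 24 = ∑ l ∈ Finset.range j, (σ.coins (i * bitCount n k + l)).toNat * 2 ^ l)
    hf₂ (by simp [hP₁.reg7]) (by decide) (by decide) (by decide)
    (fun _ _ _ h => by simpa using h) (by simp [hc₁]) ?_) hf₂ ?_
  · intro j hj σ₃ hf₃ fr₃ hj₃ ⟨hc₃, ha₃⟩
    have hpow : σ₃.arr 3 j = 2 ^ j := by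
      rw [fr₃.arr _ (by decide)]
      exact hP₁.powers j hj.le
    have hlt := draw_partial_lt σ.coins (i * bitCount n k) (j + 1)
    refine (Runs.seq (Runs.flip (Q := fun σ' => σ' = σ₃.flipInto 25) hf₃ (by omega) rfl) hf₃ ?_
      (t₂ := 1))
    rintro σ₄ hf₄ - rfl
    refine Runs.assign hf₄ (∑ l ∈ Finset.range (j + 1),
      (σ.coins (i * bitCount n k + l)).toNat * 2 ^ l) ?_
      (hlt.trans_le (Nat.pow_le_pow_right (by norm_num) (by omega))) ?_
    · simp [NExp.eval, hj₃, hpow, ha₃, hc₃, Finset.sum_range_succ]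
    · simp only [State.setReg_coins, State.flipInto_coins, State.setReg_reg, if_true, hc₃, and_true]
      funext l
      congr 1
      omega
  · rintro σ₃ hf₃ fr₃ ⟨hc₃, ha₃⟩
    have hP₃ : Prepared C k σ₃ := by
      have h2 : Prepared C k (σ₁.setReg 24 0) :=
        hP₁.of_frame (Frame.assign 24 (.const 0) σ₁ 0) (by decide) (by decide) (by decide)
      exact h2.of_frame fr₃ (by decide) (by decide) (by decide)
    have hi₃ : σ₃.reg 22 = i := by
      rw [fr₃.reg _ (by decide)]; simpa using hi₁
    have harr : σ₃.arr = σ₁.arr := by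
      funext a; rw [fr₃.arr a (by simp [Prog.arrs, Prog.forTo])]; rfl
    have hcol := drawnColour_lt n k σ.coins i
    have hex := drawnExponent_lt n k σ.coins i
    have hcL := colourCount_le_bitCount n k
    have heL : exponentCount k ≤ bitCount n k := by
      have := Nat.le_mul_of_pos_left (exponentCount k) (colourCount_pos k)
      unfold bitCount pairCount; omega
    have h2S := @Nat.lt_two_pow_self S
    refine Runs.seq (Runs.store (Q := fun σ' => σ' = σ₃.setArr 4 i (drawnColour n k σ.coins i))
      hf₃ i _ (by simp [NExp.eval, hi₃]) ?_ (by omega) (by omega) rfl) hf₃ ?_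
    · simp only [NExp.eval, ha₃, hP₃.reg6, hP₃.reg5]; rfl
    · rintro σ₄ hf₄ - rfl
      refine Runs.store hf₄ i (drawnExponent n k σ.coins i) (by simp [NExp.eval, hi₃]) ?_
        (by omega) (by omega) ⟨?_, ?_⟩
      · simp only [NExp.eval, State.setArr_reg, ha₃, hP₃.reg6, hP₃.reg5]; rfl
      · simp only [State.setArr_coins, hc₃]
        funext l; congr 1; ring
      · intro i' hi'
        by_cases h : i' = i
        · subst h; simp
        · simpa [h, harr] using ha₁ i' (by omega)

theorem runs_clear (hσ : σ.Fits S) (hP : Prepared C k σ) (hS : spaceNeed n k C.size ≤ S) :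
    Runs S Prog.clear σ (shift k * (1 + 2) + 2) fun σ' => ∀ d < shift k, σ'.farr 3 d = 0 := by
  have hDS : shift k < S := by
    have := shift_le_truncation k
    have := truncation_le_mul (k := k) C.size_pos
    unfold spaceNeed at hS; omega
  refine Runs.forTo (fun i σ' => ∀ d < i, σ'.farr 3 d = 0) hσ hP.reg8 (by decide) (by decide)
    (by decide) (fun _ _ _ h => h) (by simp) ?_
  intro i hi σ₁ hf₁ fr₁ hi₁ h₁
  refine Runs.fstore hf₁ i 0 hi₁ rfl (by omega) ?_
  intro d hd
  by_cases h : d = i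
  · simp [h]
  · simpa [h] using h₁ d (by omega)

theorem runs_popcount {T : ℕ} (hσ : σ.Fits S) (hP : Prepared C k σ)
    (hS : spaceNeed n k C.size ≤ S) (hT : σ.reg 27 = T) :
    Runs S Prog.popcount σ (colourCount k * (1 + 2) + 3) fun σ' =>
      σ'.reg 29 = popcount (colourCount k) T := by
  have hmL := colourCount_le_bitCount n k
  have hLS : bitCount n k < S := by unfold spaceNeed at hS; omega
  refine Runs.assign_seq (t := colourCount k * (1 + 2) + 2) hσ 0 rfl (by positivity) fun hf₂ => ?_
  refine Runs.forTo (fun i σ' => σ'.reg 29 = popcount i T) hf₂ (by simp [hP.reg5]) (by decide)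
    (by decide) (by decide) (fun _ _ _ h => by simpa using h) (by simp [popcount]) ?_
  intro i hi σ₁ hf₁ fr₁ hi₁ h₁
  have hle := popcount_le (i + 1) T
  have h27 : σ₁.reg 27 = T := by rw [fr₁.reg _ (by decide)]; simpa using hT
  have hpow : σ₁.arr 3 i = 2 ^ i := by
    rw [fr₁.arr _ (by decide)]
    exact hP.powers i (by omega)
  refine Runs.assign hf₁ (popcount (i + 1) T) ?_
    (lt_of_le_of_lt (hle.trans (by omega)) Nat.lt_two_pow_self) (by simp)
  simp [NExp.eval, h₁, h27, hi₁, hpow, popcount, Finset.sum_range_succ]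

/-- The sign of `weight` is realised by choosing between addition and subtraction, its binomial
coefficient by the table in field array 1. -/
theorem runs_accumulate {T : ℕ} {z : Fin n → F[X]} {g : ℕ → F} (hσ : σ.Fits S)
    (hP : Prepared C k σ) (hS : spaceNeed n k C.size ≤ S)
    (hT : σ.reg 29 = popcount (colourCount k) T)
    (hG : ∀ i < C.size * truncation k,
      σ.farr 2 i = (C.valueAt z (i / truncation k)).coeff (i % truncation k))
    (hA : ∀ d < shift k, σ.farr 3 d = g d) :
    Runs S Prog.accumulate σ (shift k * (2 + 2) + 2) fun σ' => ∀ d < shift k, σ'.farr 3 d =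
      g d + weight F (colourCount k - k) (popcount (colourCount k) T) *
        (MvPolynomial.aeval z C.poly).coeff (k * shift k + d) := by
  have hDS : shift k < S := by
    have := shift_le_truncation k
    have := truncation_le_mul (k := k) C.size_pos
    unfold spaceNeed at hS; omega
  refine Runs.forTo (fun i σ' => ∀ d < shift k, σ'.farr 3 d = if d < i then
      g d + weight F (colourCount k - k) (popcount (colourCount k) T) *
        (MvPolynomial.aeval z C.poly).coeff (k * shift k + d) else g d) hσ hP.reg8 (by decide)
    (by decide) (by decide) (fun _ _ _ h => h) (by simpa using hA) ?_ |>.weaken le_rfl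
      (fun σ' h d hd => by simpa [hd] using h d hd)
  intro i hi σ₁ hf₁ fr₁ hi₁ h₁
  have hP₁ := hP.of_frame fr₁ (by decide) (by decide) (by decide)
  have h29 : σ₁.reg 29 = popcount (colourCount k) T := by rw [fr₁.reg _ (by decide), hT]
  have hcontr : Prog.contribution.eval σ₁ =
      ((popcount (colourCount k) T).choose (colourCount k - k) : ℕ) *
        (MvPolynomial.aeval z C.poly).coeff (k * shift k + i) := by
    have hp := popcount_le (colourCount k) T
    have hb : colourCount k - k < colourCount k + 1 := by omega
    -- The coefficient lies in the last of the `k + 1` blocks of length `shift k`, hence among those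
    -- that are stored.
    have hd : k * shift k + i < truncation k := by
      have : truncation k = k * shift k + shift k := by unfold truncation; ring
      omega
    have e₁ := hP₁.binomials (popcount (colourCount k) T * (colourCount k + 1) +
      (colourCount k - k)) (by nlinarith)
    have e₂ := hG (C.out * truncation k + (k * shift k + i)) (by
      have : (C.out + 1) * truncation k ≤ C.size * truncation k :=
        Nat.mul_le_mul_right _ C.out.2
      linarith)
    rw [← fr₁.farr 2 (by decide)] at e₂
    rw [Nat.add_comm, Nat.add_mul_div_right _ _ (by omega), Nat.div_eq_of_lt hb,
      Nat.add_mul_mod_self_right, Nat.mod_eq_of_lt hb, Nat.zero_add] at e₁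
    rw [Nat.add_comm, Nat.add_mul_div_right _ _ (truncation_pos k), Nat.div_eq_of_lt hd,
      Nat.add_mul_mod_self_right, Nat.mod_eq_of_lt hd, Nat.zero_add] at e₂
    simp only [Prog.contribution, FExp.eval, NExp.eval, hi₁, h29, hP₁.reg1, hP₁.reg3, hP₁.reg5,
      hP₁.reg8, hP₁.reg9, hP₁.reg10]
    rw [Nat.add_comm, e₁, Nat.add_comm, e₂, Circuit.valueAt, dif_pos C.out.2]
    rfl
  have hgi : σ₁.farr 3 i = g i := by simpa using h₁ i hi
  refine Runs.cond (t := 1) (fun hb => ?_) (fun hb => ?_) <;>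
    simp only [Test.Holds, NExp.eval, h29] at hb <;>
    refine Runs.fstore hf₁ i (g i + weight F (colourCount k - k) (popcount (colourCount k) T) *
        (MvPolynomial.aeval z C.poly).coeff (k * shift k + i)) hi₁ ?_ (by omega) ?_
  · have : Even (popcount (colourCount k) T) := Nat.even_iff.2 hb
    simp [FExp.eval, NExp.eval, hcontr, hi₁, hgi, weight, this.neg_one_pow]
  · intro d hd
    by_cases h : d = i
    · simp [h]
    · simpa [h, show d < i + 1 ↔ d < i by omega] using h₁ d hd
  · have : Odd (popcount (colourCount k) T) := Nat.odd_iff.2 (by omega)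
    simp [FExp.eval, NExp.eval, hcontr, hi₁, hgi, weight, this.neg_one_pow, sub_eq_add_neg]
  · intro d hd
    by_cases h : d = i
    · simp [h]
    · simpa [h, show d < i + 1 ↔ d < i by omega] using h₁ d hd

/-- Register contents `v` flag the truth of `H`. -/
def Flags (v : ℕ) (H : Prop) : Prop := (H ∧ v = 1) ∨ (¬ H ∧ v = 0)

/-- The flag is never reset, so it accumulates a disjunction; `H` stands for the success of earlier
trials. -/
theorem runs_test {H : Prop} {g : ℕ → F} (hσ : σ.Fits S) (hP : Prepared C k σ)
    (hS : spaceNeed n k C.size ≤ S) (hH : Flags (σ.reg 20) H)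
    (hg : ∀ d < shift k, σ.farr 3 d = g d) :
    Runs S Prog.test σ (shift k * (2 + 2) + 2) fun σ' =>
      Flags (σ'.reg 20) (H ∨ ∃ d < shift k, g d ≠ 0) := by
  have hS1 : 1 < 2 ^ S := Nat.one_lt_two_pow (by unfold spaceNeed at hS; omega)
  refine Runs.forTo (fun i σ' => Flags (σ'.reg 20) (H ∨ ∃ d < i, g d ≠ 0)) hσ hP.reg8 (by decide)
    (by decide) (by decide) (fun _ _ _ h => by simpa using h) (by simpa using hH) ?_
  intro i hi σ₁ hf₁ fr₁ hi₁ h₁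
  have hgi : σ₁.farr 3 i = g i := by rw [fr₁.farr _ (by decide), hg i hi]
  refine Runs.cond (t := 1) (fun hb => ?_) (fun hb => ?_) <;>
    simp only [Test.Holds, NExp.eval, FExp.eval, hi₁, hgi] at hb
  · refine Runs.assign hf₁ 1 rfl hS1 (Or.inl ⟨Or.inr ⟨i, by omega, hb⟩, by simp⟩)
  · refine Runs.skip ?_
    have : (∃ d < i + 1, g d ≠ 0) ↔ ∃ d < i, g d ≠ 0 :=
      ⟨fun ⟨d, hd, h⟩ => ⟨d, by
        rcases Nat.lt_succ_iff_lt_or_eq.1 hd with h' | h'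
        · exact h'
        · exact absurd h (h' ▸ hb), h⟩, fun ⟨d, hd, h⟩ => ⟨d, by omega, h⟩⟩
    rwa [this]

end KMMD

/-! ### Evaluating the circuit and repeating the trial -/

namespace KMMD

open Polynomial

variable {F : Type*} [Field F] {n : ℕ} {C : Circuit F n} {k S : ℕ} {σ : State F}

/-- Coefficient `d` of a product needs only coefficients up to `d` of the factors, so truncation
loses nothing. Cell `i` serves as its own accumulator; the operands belong to earlier gates, so
their cells are different from it (`hne`). -/
theorem runs_convolve {p d a b : ℕ} {u v w : F[X]} {D i : ℕ} (hσ : σ.Fits S)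
    (hi : i < S) (hd : d < D) (hDS : D < S)
    (ha : a < p) (hb : b < p) (hip : i = p * D + d)
    (h9 : σ.reg 9 = D) (h30 : σ.reg 30 = i) (h31 : σ.reg 31 = p) (h32 : σ.reg 32 = d)
    (hl : σ.arr 1 p = a) (hr : σ.arr 2 p = b)
    (hu : ∀ e < D, σ.farr 2 (a * D + e) = u.coeff e)
    (hv : ∀ e < D, σ.farr 2 (b * D + e) = v.coeff e) (hw : w = u * v) :
    Runs S Prog.convolve σ (D * 3 + 4) fun σ' =>
      σ'.farr 2 i = w.coeff d ∧ ∀ j ≠ i, σ'.farr 2 j = σ.farr 2 j := by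
  have h2S := @Nat.lt_two_pow_self S
  have hne : ∀ x < p, ∀ e < D, x * D + e ≠ i := by
    intro x hx e he
    have : (x + 1) * D ≤ p * D := Nat.mul_le_mul_right _ hx
    rw [hip]; nlinarith
  refine Runs.weaken (t₁ := 1 + ((d + 1) * (1 + 2) + 2 + 1)) ?_ (by omega) fun _ h => h
  refine Runs.seq (Runs.fstore (Q := fun σ' => σ' = σ.setFarr 2 i 0) hσ i 0 h30 rfl hi rfl) hσ ?_
  rintro σ₁ hf₁ - rfl
  refine Runs.assign_seq hf₁ (d + 1) (by simp [NExp.eval, h32]) (by omega) fun hf₂ => ?_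
  refine (Runs.forTo (fun e σ' => (σ'.farr 2 i = ∑ x ∈ Finset.range e, u.coeff x * v.coeff (d - x))
      ∧ ∀ j ≠ i, σ'.farr 2 j = σ.farr 2 j) hf₂ (by simp) (by decide) (by decide) (by decide)
    (fun _ _ _ h => h) ?_ ?_).weaken le_rfl ?_
  · simp +contextual
  · intro e he σ₃ hf₃ fr₃ he₃ ⟨h₃, h₃'⟩
    have r : ∀ x, x < 33 → σ₃.reg x = σ.reg x := by
      intro x hx
      have h1 : x ≠ 33 := by omega
      have h2 : x ≠ 34 := by omega
      rw [fr₃.reg x (by simp [Prog.forTo, Prog.regs, h2])]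
      simp [h1]
    have a₁ : σ₃.arr 1 p = a := by rw [fr₃.arr _ (by decide)]; exact hl
    have a₂ : σ₃.arr 2 p = b := by rw [fr₃.arr _ (by decide)]; exact hr
    have ea : σ₃.farr 2 (a * D + e) = u.coeff e := by
      rw [h₃' _ (hne a ha e (by omega)), hu e (by omega)]
    have eb : σ₃.farr 2 (b * D + (d - e)) = v.coeff (d - e) := by
      rw [h₃' _ (hne b hb _ (by omega)), hv _ (by omega)]
    refine Runs.fstore hf₃ i (∑ x ∈ Finset.range (e + 1), u.coeff x * v.coeff (d - x)) ?_ ?_ hi ?_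
    · simp [NExp.eval, r, h30]
    · simp only [FExp.eval, NExp.eval, r, h30, h31, h32, h9, a₁, a₂, he₃, ea, eb, h₃,
        Finset.sum_range_succ, Nat.reduceLT]
    · exact ⟨by simp, fun j hj => by simpa [hj] using h₃' j hj⟩
  · rintro σ' ⟨h, h'⟩
    refine ⟨?_, h'⟩
    rw [h, hw, coeff_mul, Finset.Nat.sum_antidiagonal_eq_sum_range_succ
      (fun x y => u.coeff x * v.coeff y)]

/-- A single loop visits the pairs of a gate `p` and a coefficient `d` in the order of `p * D + d`,
so all coefficients of the operands are ready when a gate is reached. By `hcol` the table of powers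
of two contains the entries that the test for membership of a colour in `T` needs. -/
theorem runs_evaluate {T : ℕ} {col ex : ℕ → ℕ} (hσ : σ.Fits S)
    (hP : Prepared C k σ) (hS : spaceNeed n k C.size ≤ S) (hT : σ.reg 27 = T)
    (hc : ∀ i < n, σ.arr 4 i = col i) (he : ∀ i < n, σ.arr 5 i = ex i)
    (hcol : ∀ i, col i ≤ bitCount n k) :
    Runs S Prog.evaluate σ (C.size * truncation k * ((truncation k * 3 + 9) + 2) + 2) fun σ' =>
      ∀ i < C.size * truncation k, σ'.farr 2 i =
        (C.valueAt (point F n (shift k) col ex T) (i / truncation k)).coeff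
          (i % truncation k) := by
  set z := point F n (shift k) col ex T with hz
  set D := truncation k with hD
  have hD0 : 0 < D := truncation_pos k
  have hDs : D ≤ C.size * D := truncation_le_mul C.size_pos
  have hsDS : C.size * D < S := by unfold spaceNeed at hS; rw [← hD] at hS; omega
  have h2S := @Nat.lt_two_pow_self S
  refine Runs.forTo (fun i σ' => ∀ j < i, σ'.farr 2 j = (C.valueAt z (j / D)).coeff (j % D))
    hσ hP.reg13 (by decide) (by decide) (by decide) (fun _ _ _ h => h) (by simp) ?_
  intro i hi σ₁ hf₁ fr₁ hi₁ h₁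
  have hP₁ := hP.of_frame fr₁ (by decide) (by decide) (by decide)
  obtain ⟨p, d, hd, hip⟩ : ∃ p d, d < D ∧ i = p * D + d :=
    ⟨i / D, i % D, Nat.mod_lt _ hD0, (Nat.div_add_mod' i D).symm⟩
  have hdiv : i / D = p := by
    rw [hip, Nat.add_comm, Nat.add_mul_div_right _ _ hD0, Nat.div_eq_of_lt hd, Nat.zero_add]
  have hmod : i % D = d := by
    rw [hip, Nat.add_comm, Nat.add_mul_mod_self_right, Nat.mod_eq_of_lt hd]
  have hp : p < C.size := by
    rw [← hdiv]; exact Nat.div_lt_of_lt_mul (by rwa [mul_comm])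
  have hpS : p < S := by
    have : p * 1 ≤ p * D := Nat.mul_le_mul_left _ hD0
    omega
  refine (Runs.assign_seq (t := 3 * D + 8) hf₁ p ?_ (by omega) fun hf₂ => ?_).weaken (by omega)
    fun _ h => h
  · simp only [NExp.eval, hi₁, hP₁.reg9]; exact hdiv
  refine (Runs.assign_seq (t := 3 * D + 7) hf₂ d ?_ (by omega) fun hf₃ => ?_).weaken (by omega)
    fun _ h => h
  · simp only [NExp.eval, State.setReg_reg]; simp [hi₁, hP₁.reg9, ← hD, hmod]
  set σ₃ := (σ₁.setReg 31 p).setReg 32 d with hσ₃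
  have r30 : σ₃.reg 30 = i := by simp [hσ₃, hi₁]
  have r31 : σ₃.reg 31 = p := by simp [hσ₃]
  have r32 : σ₃.reg 32 = d := by simp [hσ₃]
  have hP₃ : Prepared C k σ₃ := by
    have h2 : Prepared C k (σ₁.setReg 31 p) :=
      hP₁.of_frame (Frame.assign 31 (.const 0) σ₁ p) (by decide) (by decide) (by decide)
    exact h2.of_frame (Frame.assign 32 (.const 0) _ d) (by decide) (by decide) (by decide)
  have r27 : σ₃.reg 27 = T := by
    simp [hσ₃]; rw [fr₁.reg _ (by decide), hT]
  have a₄ : ∀ i < n, σ₃.arr 4 i = col i := by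
    intro i hi
    rw [← hc i hi, ← fr₁.arr 4 (by decide)]; rfl
  have a₅ : ∀ i < n, σ₃.arr 5 i = ex i := by
    intro i hi
    rw [← he i hi, ← fr₁.arr 5 (by decide)]; rfl
  have h₃ : ∀ j < i, σ₃.farr 2 j = (C.valueAt z (j / D)).coeff (j % D) := h₁
  have h₃' : ∀ x < p, ∀ e < D, σ₃.farr 2 (x * D + e) = (C.valueAt z x).coeff e := by
    intro x hx e he
    have : (x + 1) * D ≤ p * D := Nat.mul_le_mul_right _ hx
    rw [h₃ _ (by nlinarith)]
    rw [Nat.add_comm, Nat.add_mul_div_right _ _ hD0, Nat.div_eq_of_lt he, Nat.zero_add,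
      Nat.add_mul_mod_self_right, Nat.mod_eq_of_lt he]
  have hcode := hP₃.codes p hp
  have hleft := hP₃.lefts p hp
  have hright := hP₃.rights p hp
  have hscalar := hP₃.scalars p hp
  -- The invariant reduces to one correct write and no other change to the table.
  suffices H : Runs S _ σ₃ (3 * D + 7) fun σ' =>
      σ'.farr 2 i = (C.valueAt z p).coeff d ∧ ∀ j ≠ i, σ'.farr 2 j = σ₃.farr 2 j by
    refine H.weaken le_rfl ?_
    rintro σ' ⟨h, h'⟩ j hj
    by_cases hji : j = i
    · rw [hji, h, hdiv, hmod]
    · rw [h' j hji, h₃ j (by omega)]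
  have store : ∀ (e : FExp), e.eval σ₃ = (C.valueAt z p).coeff d →
      Runs S (.fstore 2 (.reg 30) e) σ₃ 1 fun σ' =>
        σ'.farr 2 i = (C.valueAt z p).coeff d ∧ ∀ j ≠ i, σ'.farr 2 j = σ₃.farr 2 j := by
    intro e he
    exact Runs.fstore hf₃ i _ r30 he (by omega) ⟨by simp, fun j hj => by simp [hj]⟩
  refine (Runs.cond (t := 3 * D + 6) (fun hb => ?_) (fun hb => ?_)).weaken (by omega)
    fun _ h => h
  all_goals simp only [Test.Holds, NExp.eval, r31, hcode] at hb
  · refine (Runs.cond (t := 1) (fun hb' => store _ ?_) (fun hb' => store _ ?_)).weaken (by omega)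
      fun _ h => h
    all_goals
      cases hg : C.gate ⟨p, hp⟩ with
      | var v =>
        rw [hg] at hleft
        simp only [Gate.left] at hleft
        simp only [Test.Holds, NExp.eval, r31, r32, r27, hP₃.reg8, hleft, a₄ v v.2, a₅ v v.2,
          hP₃.powers _ (hcol v)] at hb'
        rw [C.valueAt_var z hp hg, hz, point]
        -- The first alternative serves the branch that stores 1; the second serves the branch that
        -- stores 0, where either half of the test may have failed.
        first
        | simp [hb'.1, hb'.2, FExp.eval, coeff_X_pow]
        | split_ifs with h
          · simp [FExp.eval, coeff_X_pow, show d ≠ shift k + ex v from fun h' => hb' ⟨h, h'⟩]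
          · simp [FExp.eval]
      | const c => simp [hg, Gate.code] at hb
      | add a b => simp [hg, Gate.code] at hb
      | mul a b => simp [hg, Gate.code] at hb
  refine (Runs.cond (t := 3 * D + 5) (fun hb₂ => ?_) (fun hb₂ => ?_)).weaken (by omega)
    fun _ h => h
  all_goals simp only [Test.Holds, NExp.eval, r31, hcode] at hb₂
  · refine (Runs.cond (t := 1) (fun hb' => store _ ?_) (fun hb' => store _ ?_)).weaken (by omega)
      fun _ h => h
    all_goals
      cases hg : C.gate ⟨p, hp⟩ with
      | var v => simp [hg, Gate.code] at hb
      | const c =>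
        rw [hg] at hscalar
        simp only [Gate.scalar] at hscalar
        simp only [Test.Holds, NExp.eval, r32] at hb'
        rw [C.valueAt_const z hp hg, coeff_C]
        simp [hb', FExp.eval, NExp.eval, r31, hscalar]
      | add a b => simp [hg, Gate.code] at hb₂
      | mul a b => simp [hg, Gate.code] at hb₂
  refine (Runs.cond (t := 3 * D + 4) (fun hb₃ => ?_) (fun hb₃ => ?_)).weaken (by omega)
    fun _ h => h
  all_goals simp only [Test.Holds, NExp.eval, r31, hcode] at hb₃
  · refine (store _ ?_).weaken (by omega) fun _ h => h
    cases hg : C.gate ⟨p, hp⟩ with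
    | var v => simp [hg, Gate.code] at hb
    | const c => simp [hg, Gate.code] at hb₂
    | add a b =>
      rw [hg] at hleft hright
      simp only [Gate.left, Gate.right] at hleft hright
      rw [C.valueAt_add z hp hg, coeff_add, ← h₃' a a.2 d hd, ← h₃' b b.2 d hd]
      simp only [FExp.eval, NExp.eval, r31, r32, hleft, hright, hP₃.reg9]
      rfl
    | mul a b => simp [hg, Gate.code] at hb₃
  · cases hg : C.gate ⟨p, hp⟩ with
    | var v => simp [hg, Gate.code] at hb
    | const c => simp [hg, Gate.code] at hb₂
    | add a b => simp [hg, Gate.code] at hb₃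
    | mul a b =>
      rw [hg] at hleft hright
      simp only [Gate.left, Gate.right] at hleft hright
      exact (runs_convolve hf₃ (by omega) hd (by omega) a.2 b.2 hip hP₃.reg9 r30 r31 r32 hleft
        hright (h₃' a a.2) (h₃' b b.2) (C.valueAt_mul z hp hg)).weaken (by omega) fun _ h => h

/-- A bound on the time spent on one set of colours. -/
def setTime (k s : ℕ) : ℕ :=
  (colourCount k * (1 + 2) + 3) + ((s * truncation k * ((truncation k * 3 + 9) + 2) + 2) +
    (shift k * (2 + 2) + 2))

/-- The loop counter is itself the binary code of the set of colours, and only the running sum is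
kept; this keeps the space polynomial. -/
theorem runs_sumSets {col ex : ℕ → ℕ} (hσ : σ.Fits S)
    (hP : Prepared C k σ) (hS : spaceNeed n k C.size ≤ S)
    (hc : ∀ i < n, σ.arr 4 i = col i) (he : ∀ i < n, σ.arr 5 i = ex i)
    (hcol : ∀ i, col i ≤ bitCount n k) (hA : ∀ d < shift k, σ.farr 3 d = 0) :
    Runs S Prog.sumSets σ (2 ^ colourCount k * (setTime k C.size + 2) + 2) fun σ' =>
      ∀ d < shift k, σ'.farr 3 d = sievedCoeff k C.poly col ex d := by
  refine Runs.forTo (fun N σ' => ∀ d < shift k, σ'.farr 3 d = ∑ T ∈ Finset.range N,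
    weight F (colourCount k - k) (popcount (colourCount k) T) *
      (MvPolynomial.aeval (point F n (shift k) col ex T) C.poly).coeff (k * shift k + d))
    hσ hP.reg12 (by decide) (by decide) (by decide) (fun _ _ _ h => h) (by simpa using hA) ?_
  intro T hT σ₁ hf₁ fr₁ hT₁ h₁
  have hP₁ := hP.of_frame fr₁ (by decide) (by decide) (by decide)
  refine Runs.seq (runs_popcount hf₁ hP₁ hS hT₁) hf₁ fun σ₂ hf₂ fr₂ h₂ => ?_
  have hP₂ := hP₁.of_frame fr₂ (by decide) (by decide) (by decide)
  have hT₂ : σ₂.reg 27 = T := by rw [fr₂.reg _ (by decide), hT₁]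
  have a₄ : ∀ i < n, σ₂.arr 4 i = col i := fun i hi => by
    rw [fr₂.arr 4 (by decide), fr₁.arr 4 (by decide), hc i hi]
  have a₅ : ∀ i < n, σ₂.arr 5 i = ex i := fun i hi => by
    rw [fr₂.arr 5 (by decide), fr₁.arr 5 (by decide), he i hi]
  refine Runs.seq (runs_evaluate hf₂ hP₂ hS hT₂ a₄ a₅ hcol) hf₂ fun σ₃ hf₃ fr₃ h₃ => ?_
  have hP₃ := hP₂.of_frame fr₃ (by decide) (by decide) (by decide)
  refine (runs_accumulate hf₃ hP₃ hS (T := T) (by rw [fr₃.reg _ (by decide), h₂]) h₃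
    (g := σ₁.farr 3) fun d _ => by rw [fr₃.farr 3 (by decide), fr₂.farr 3 (by decide)]).weaken
      le_rfl fun σ₄ h₄ d hd => ?_
  rw [h₄ d hd, h₁ d hd, Finset.sum_range_succ]

/-- A bound on the time of a trial. -/
def trialTime (n k s : ℕ) : ℕ :=
  (n * ((bitCount n k * 4 + 5) + 2) + 2) + ((shift k * (1 + 2) + 2) +
    ((2 ^ colourCount k * (setTime k s + 2) + 2) + (shift k * (2 + 2) + 2)))

/-- The invariant records how far the tape has advanced, which identifies the block of coins that
each trial reads in terms of the initial tape. -/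
theorem runs_trials (hσ : σ.Fits S) (hP : Prepared C k σ) (hS : spaceNeed n k C.size ≤ S)
    (h20 : σ.reg 20 = 0) :
    Runs S Prog.trials σ (trialCount k * (trialTime n k C.size + 2) + 2) fun σ' =>
      Flags (σ'.reg 20) (∃ τ < trialCount k, TrialHits k C.poly σ.coins τ) := by
  refine (Runs.forTo (fun N σ' => σ'.coins = (fun j => σ.coins (j + N * (n * bitCount n k))) ∧
    Flags (σ'.reg 20) (∃ τ < N, TrialHits k C.poly σ.coins τ))
    hσ hP.reg11 (by decide) (by decide) (by decide) (fun _ _ _ h => by simpa using h)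
    (by simp [Flags, h20]) ?_).weaken le_rfl fun _ h => h.2
  rintro τ hτ σ₁ hf₁ fr₁ hτ₁ ⟨hc₁, h₁⟩
  have hP₁ := hP.of_frame fr₁ (by decide) (by decide) (by decide)
  refine Runs.seq (runs_sample hf₁ hP₁ hS) hf₁ fun σ₂ hf₂ fr₂ ⟨hc₂, h₂⟩ => ?_
  have hP₂ := hP₁.of_frame fr₂ (by decide) (by decide) (by decide)
  refine Runs.seq (runs_clear hf₂ hP₂ hS) hf₂ fun σ₃ hf₃ fr₃ h₃ => ?_
  have hP₃ := hP₂.of_frame fr₃ (by decide) (by decide) (by decide)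
  refine Runs.seq (runs_sumSets hf₃ hP₃ hS (col := drawnColour n k σ₁.coins)
    (ex := drawnExponent n k σ₁.coins)
    (fun i hi => by rw [fr₃.arr 4 (by decide)]; exact (h₂ i hi).1)
    (fun i hi => by rw [fr₃.arr 5 (by decide)]; exact (h₂ i hi).2)
    (fun i => (drawnColour_lt n k _ i).le.trans (colourCount_le_bitCount n k)) h₃) hf₃
    fun σ₄ hf₄ fr₄ h₄ => ?_
  have hP₄ := hP₃.of_frame fr₄ (by decide) (by decide) (by decide)
  have e₄ : σ₄.reg 20 = σ₁.reg 20 := by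
    rw [fr₄.reg _ (by decide), fr₃.reg _ (by decide), fr₂.reg _ (by decide)]
  refine ((runs_test hf₄ hP₄ hS (e₄.symm ▸ h₁) h₄).with_frame hf₄).weaken le_rfl ?_
  rintro σ₅ ⟨h₅, -, fr₅⟩
  refine ⟨?_, ?_⟩
  · rw [fr₅.coins (by decide), fr₄.coins (by decide), fr₃.coins (by decide), hc₂, hc₁]
    funext j
    dsimp only
    congr 1
    ring
  · convert h₅ using 1
    rw [hc₁]
    -- A nonzero sieved coefficient computed from the shifted tape is `TrialHits` at `τ` by
    -- definition.
    change _ ↔ ((∃ τ' < τ, TrialHits k C.poly σ.coins τ') ∨ TrialHits k C.poly σ.coins τ)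
    refine ⟨fun ⟨t, ht, h⟩ => ?_, ?_⟩
    · rcases Nat.lt_succ_iff_lt_or_eq.1 ht with h' | rfl
      · exact Or.inl ⟨t, h', h⟩
      · exact Or.inr h
    · rintro (⟨t, ht, h⟩ | h)
      · exact ⟨t, by omega, h⟩
      · exact ⟨τ, by omega, h⟩

end KMMD

/-! ### Precomputation and the run of the whole program -/

namespace KMMD

open Polynomial

variable {F : Type*} [Field F] {n : ℕ} {C : Circuit F n} {k S : ℕ} {σ : State F}

/-- From `503 ≤ 2 ^ 9` and `q < 2 ^ q`: the number of trials is exponential, but its bit length is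
linear, so it fits into a register. -/
theorem trialCount_lt (k : ℕ) : trialCount k < 2 ^ (10 * blockCount k + 10) := by
  unfold trialCount
  set q := blockCount k
  have h1 : 503 ^ q / 100 ^ q ≤ 2 ^ (9 * q) := by
    refine (Nat.div_le_self _ _).trans ?_
    rw [pow_mul]
    exact Nat.pow_le_pow_left (by norm_num) q
  have h2 : q < 2 ^ q := Nat.lt_two_pow_self
  have h3 : 0 < 2 ^ (9 * q) := by positivity
  calc 24 * q * (503 ^ q / 100 ^ q + 1) ≤ (24 * 2 ^ q) * (2 ^ (9 * q) + 2 ^ (9 * q)) := by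
        gcongr; omega
    _ = 48 * 2 ^ (10 * q) := by rw [show 10 * q = q + 9 * q by ring, pow_add]; ring
    _ < 2 ^ (10 * q + 10) := by rw [pow_add]; nlinarith [show 0 < 2 ^ (10 * q) by positivity]

/-- The registers set by the first part of the program. -/
structure Computed (n k s o : ℕ) (σ : State F) : Prop where
  reg0 : σ.reg 0 = n
  reg1 : σ.reg 1 = k
  reg3 : σ.reg 3 = o
  reg4 : σ.reg 4 = blockCount k
  reg5 : σ.reg 5 = colourCount k
  reg6 : σ.reg 6 = pairCount k
  reg7 : σ.reg 7 = bitCount n k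
  reg8 : σ.reg 8 = shift k
  reg9 : σ.reg 9 = truncation k
  reg10 : σ.reg 10 = colourCount k - k
  reg13 : σ.reg 13 = s * truncation k
  reg14 : σ.reg 14 = bitCount n k + 1
  reg15 : σ.reg 15 = (colourCount k + 1) * (colourCount k + 1)

theorem runs_parameters {s o : ℕ} (hσ : σ.Fits S) (hs : 0 < s) (hS : spaceNeed n k s ≤ S)
    (h0 : σ.reg 0 = n) (h1 : σ.reg 1 = k) (h2 : σ.reg 2 = s) (h3 : σ.reg 3 = o) :
    Runs S Prog.parameters σ 10 (Computed n k s o) := by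
  have hlt : ∀ v ≤ S, v < 2 ^ S := fun v hv => hv.trans_lt Nat.lt_two_pow_self
  have := colourCount_le_bitCount n k
  have := shift_le_truncation k
  have := truncation_le_mul (k := k) hs
  have : pairCount k ≤ bitCount n k := by simp [bitCount]
  unfold spaceNeed at hS
  refine Runs.assign_seq (t := 9) hσ (blockCount k) ?_ (hlt _ (by omega)) fun hσ => ?_
  · simp [NExp.eval, h1, blockCount]
  refine Runs.assign_seq (t := 8) hσ (colourCount k) ?_ (hlt _ (by omega)) fun hσ => ?_
  · simp [NExp.eval, colourCount]
  refine Runs.assign_seq (t := 7) hσ (pairCount k) ?_ (hlt _ (by omega)) fun hσ => ?_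
  · simp [NExp.eval, pairCount, exponentCount]
  refine Runs.assign_seq (t := 6) hσ (bitCount n k) ?_ (hlt _ (by omega)) fun hσ => ?_
  · simp [NExp.eval, bitCount, h0]
  refine Runs.assign_seq (t := 5) hσ (shift k) ?_ (hlt _ (by omega)) fun hσ => ?_
  · simp [NExp.eval, shift, exponentCount, h1]
  refine Runs.assign_seq (t := 4) hσ (truncation k) ?_ (hlt _ (by omega)) fun hσ => ?_
  · simp [NExp.eval, truncation, h1]
  refine Runs.assign_seq (t := 3) hσ (colourCount k - k) ?_ (hlt _ (by omega)) fun hσ => ?_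
  · simp [NExp.eval, h1]
  refine Runs.assign_seq (t := 2) hσ (s * truncation k) ?_ (hlt _ (by omega)) fun hσ => ?_
  · simp [NExp.eval, h2]
  refine Runs.assign_seq (t := 1) hσ (bitCount n k + 1) ?_ (hlt _ (by omega)) fun hσ => ?_
  · simp [NExp.eval]
  refine Runs.assign hσ ((colourCount k + 1) * (colourCount k + 1)) ?_ (hlt _ (by omega)) ?_
  · simp [NExp.eval]
  · constructor <;> simp [h0, h1, h3]

theorem Computed.of_frame {K : Type*} {n k s o : ℕ} {σ σ' : State K} {p : Prog}
    (h : Computed n k s o σ) (fr : Frame p σ σ')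
    (h₁ : ∀ x < 16, x ≠ 11 → x ≠ 12 → x ∉ p.regs) : Computed n k s o σ' := by
  constructor
  case reg0 => rw [fr.reg _ (h₁ _ (by omega) (by omega) (by omega)), h.reg0]
  case reg1 => rw [fr.reg _ (h₁ _ (by omega) (by omega) (by omega)), h.reg1]
  case reg3 => rw [fr.reg _ (h₁ _ (by omega) (by omega) (by omega)), h.reg3]
  case reg4 => rw [fr.reg _ (h₁ _ (by omega) (by omega) (by omega)), h.reg4]
  case reg5 => rw [fr.reg _ (h₁ _ (by omega) (by omega) (by omega)), h.reg5]
  case reg6 => rw [fr.reg _ (h₁ _ (by omega) (by omega) (by omega)), h.reg6]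
  case reg7 => rw [fr.reg _ (h₁ _ (by omega) (by omega) (by omega)), h.reg7]
  case reg8 => rw [fr.reg _ (h₁ _ (by omega) (by omega) (by omega)), h.reg8]
  case reg9 => rw [fr.reg _ (h₁ _ (by omega) (by omega) (by omega)), h.reg9]
  case reg10 => rw [fr.reg _ (h₁ _ (by omega) (by omega) (by omega)), h.reg10]
  case reg13 => rw [fr.reg _ (h₁ _ (by omega) (by omega) (by omega)), h.reg13]
  case reg14 => rw [fr.reg _ (h₁ _ (by omega) (by omega) (by omega)), h.reg14]
  case reg15 => rw [fr.reg _ (h₁ _ (by omega) (by omega) (by omega)), h.reg15]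

/-- Register 37 is doubled once more after the last store, so `2 ^ N` has to fit as well. -/
theorem runs_powers {N : ℕ} (hσ : σ.Fits S) (h14 : σ.reg 14 = N) (hN : N < S) :
    Runs S Prog.powers σ (N * (2 + 2) + 3) fun σ' => ∀ j < N, σ'.arr 3 j = 2 ^ j := by
  refine Runs.assign_seq (t := N * (2 + 2) + 2) hσ 1 rfl
    (Nat.one_lt_two_pow (by omega)) fun hf₂ => ?_
  refine (Runs.forTo (fun i σ' => σ'.reg 37 = 2 ^ i ∧ ∀ j < i, σ'.arr 3 j = 2 ^ j) hf₂
    (by simp [h14]) (by decide) (by decide) (by decide) (fun _ _ _ h => by simpa using h)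
    (by simp) ?_).weaken le_rfl fun _ h => h.2
  rintro i hi σ₁ hf₁ - hi₁ ⟨h₁, h₁'⟩
  refine Runs.seq (t₂ := 1) (Runs.store (Q := fun σ' => σ' = σ₁.setArr 3 i (2 ^ i)) hf₁ i (2 ^ i)
    hi₁ h₁ (by omega) (Nat.pow_lt_pow_right (by norm_num) (by omega)) rfl) hf₁ ?_
  rintro σ₂ hf₂ - rfl
  refine Runs.assign hf₂ (2 ^ (i + 1)) ?_ (Nat.pow_lt_pow_right (by norm_num) (by omega)) ⟨?_, ?_⟩
  · simp [NExp.eval, h₁, pow_succ, mul_two]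
  · simp
  · intro j hj
    by_cases h : j = i
    · simp [h]
    · simpa [h] using h₁' j (by omega)

theorem runs_countTrials (hσ : σ.Fits S) (h4 : σ.reg 4 = blockCount k)
    (hS : 10 * blockCount k + 10 ≤ S) :
    Runs S Prog.countTrials σ (blockCount k * (2 + 2) + 5) fun σ' =>
      σ'.reg 11 = trialCount k := by
  have h1S : 1 < 2 ^ S := Nat.one_lt_two_pow (by omega)
  have hpow : ∀ b ≤ 512, ∀ i ≤ blockCount k, b ^ i < 2 ^ S := fun b hb i hi => by
    calc b ^ i ≤ 512 ^ i := Nat.pow_le_pow_left hb i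
      _ = 2 ^ (9 * i) := by rw [pow_mul]; norm_num
      _ < 2 ^ S := Nat.pow_lt_pow_right (by norm_num) (by omega)
  refine Runs.weaken (t₁ := ((blockCount k * (2 + 2) + 2 + 1) + 1) + 1) ?_ (by omega) fun _ h => h
  refine Runs.assign_seq (t := (blockCount k * (2 + 2) + 2 + 1) + 1) hσ 1 rfl h1S fun hf => ?_
  refine Runs.assign_seq (t := blockCount k * (2 + 2) + 2 + 1) hf 1 rfl h1S fun hf => ?_
  refine Runs.seq (t₁ := blockCount k * (2 + 2) + 2) (Runs.forTo (fun i σ' => σ'.reg 39 = 503 ^ i ∧ σ'.reg 40 = 100 ^ i) hf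
    (by simp [h4]) (by decide) (by decide) (by decide) (fun _ _ _ h => by simpa using h)
    (by simp) ?_) hf ?_
  · rintro i hi σ₁ hf₁ - - ⟨h₁, h₁'⟩
    refine Runs.assign_seq hf₁ (503 ^ (i + 1)) (by simp [NExp.eval, h₁, pow_succ])
      (hpow _ (by norm_num) _ (by omega)) fun hf₂ => ?_
    exact Runs.assign hf₂ (100 ^ (i + 1)) (by simp [NExp.eval, h₁', pow_succ])
      (hpow _ (by norm_num) _ (by omega)) (by simp)
  · rintro σ₁ hf₁ fr₁ ⟨h₁, h₁'⟩
    refine Runs.assign hf₁ (trialCount k) ?_ ((trialCount_lt k).trans_le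
      (Nat.pow_le_pow_right (by norm_num) hS)) (by simp)
    have : σ₁.reg 4 = blockCount k := by rw [fr₁.reg _ (by decide)]; simpa using h4
    simp [NExp.eval, h₁, h₁', this, trialCount]

/-- Field expressions cannot convert natural numbers, so the binomial coefficients are built inside
`F` by Pascal's rule, in a square table stored row by row. -/
theorem runs_pascal {m : ℕ} (hσ : σ.Fits S) (h5 : σ.reg 5 = m)
    (h15 : σ.reg 15 = (m + 1) * (m + 1)) (hS : (m + 1) * (m + 1) ≤ S) :
    Runs S Prog.pascal σ ((m + 1) * (m + 1) * (3 + 2) + 2) fun σ' =>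
      ∀ i < (m + 1) * (m + 1), σ'.farr 1 i = (((i / (m + 1)).choose (i % (m + 1)) : ℕ) : F) := by
  refine Runs.forTo (fun i σ' => ∀ j < i, σ'.farr 1 j = (((j / (m + 1)).choose (j % (m + 1)) : ℕ) : F))
    hσ h15 (by decide) (by decide) (by decide) (fun _ _ _ h => h) (by simp) ?_
  intro i hi σ₁ hf₁ fr₁ hi₁ h₁
  have h5' : σ₁.reg 5 = m := by rw [fr₁.reg _ (by decide), h5]
  have store : ∀ (e : FExp), e.eval σ₁ = (((i / (m + 1)).choose (i % (m + 1)) : ℕ) : F) →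
      Runs S (.fstore 1 (.reg 42) e) σ₁ 1 fun σ' =>
        ∀ j < i + 1, σ'.farr 1 j = (((j / (m + 1)).choose (j % (m + 1)) : ℕ) : F) := by
    intro e he
    refine Runs.fstore hf₁ i _ hi₁ he (by omega) fun j hj => ?_
    by_cases h : j = i
    · simp [h]
    · simpa [h] using h₁ j (by omega)
  refine Runs.cond (t := 2) (fun hb => (store _ ?_).weaken (by omega) fun _ h => h)
    (fun hb => Runs.cond (t := 1) (fun hb' => store _ ?_) (fun hb' => store _ ?_))
  all_goals simp only [Test.Holds, NExp.eval, hi₁, h5'] at hb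
  · simp [FExp.eval, hb]
  all_goals simp only [Test.Holds, NExp.eval, hi₁, h5'] at hb'
  · rw [Nat.div_eq_of_lt hb', Nat.mod_eq_of_lt hb']
    rw [Nat.mod_eq_of_lt hb'] at hb
    simp [FExp.eval, Nat.choose_eq_zero_of_lt (Nat.pos_of_ne_zero hb)]
  -- Outside row 0 and column 0 the entry has coordinates `(s + 1, j + 1)`; Pascal's rule reads `(s,
  -- j)` and `(s, j + 1)` from the row above.
  · obtain ⟨s, j, hj, rfl⟩ : ∃ s j, j < m ∧ i = (s + 1) * (m + 1) + (j + 1) := by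
      have h1 := Nat.div_add_mod' i (m + 1)
      have h2 := Nat.mod_lt i (show 0 < m + 1 by omega)
      have h3 : 0 < i / (m + 1) := Nat.div_pos (by omega) (by omega)
      refine ⟨i / (m + 1) - 1, i % (m + 1) - 1, by omega, ?_⟩
      rw [show i / (m + 1) - 1 + 1 = i / (m + 1) by omega]
      omega
    have key : ∀ s j, j < m + 1 → (s * (m + 1) + j) / (m + 1) = s ∧
        (s * (m + 1) + j) % (m + 1) = j := by
      intro s j hj
      rw [Nat.add_comm, Nat.add_mul_div_right _ _ (by omega), Nat.div_eq_of_lt hj,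
        Nat.add_mul_mod_self_right, Nat.mod_eq_of_lt hj]
      simp
    have e1 : s * (m + 1) + (j + 1) - 1 = s * (m + 1) + j := by omega
    have e2 : (s + 1) * (m + 1) + (j + 1) - (m + 1) = s * (m + 1) + (j + 1) := by
      rw [Nat.succ_mul]; omega
    have l2 : s * (m + 1) + (j + 1) < (s + 1) * (m + 1) + (j + 1) := by
      rw [Nat.succ_mul]; omega
    have f1 := h₁ (s * (m + 1) + j) (by omega)
    have f2 := h₁ (s * (m + 1) + (j + 1)) l2
    rw [(key _ _ (by omega)).1, (key _ _ (by omega)).2] at f1 f2 ⊢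
    simp only [FExp.eval, NExp.eval, hi₁, h5', e1, e2, f1, f2, Nat.choose_succ_succ']
    push_cast
    ring

/-- A bound on the time of the whole program. -/
def totalTime (n k s : ℕ) : ℕ :=
  10 + (((bitCount n k + 1) * (2 + 2) + 3) + ((blockCount k * (2 + 2) + 5 +
    ((colourCount k + 1) * (colourCount k + 1) * (3 + 2) + 2 +
      ((trialCount k * (trialTime n k s + 2) + 2) + 1))) + 1))

/-- The interface between machine and mathematics: the answer is a deterministic function of the
coins, and `Flags` fixes it in both directions. -/
theorem runs_detect (C : Circuit F n) (k : ℕ) (ω : ℕ → Bool) (hσ : (initState C k ω).Fits S)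
    (hS : spaceNeed n k C.size ≤ S) :
    Runs S Prog.detect (initState C k ω) (totalTime n k C.size) fun σ' =>
      Flags (σ'.reg 0) (∃ τ < trialCount k, TrialHits k C.poly ω τ) := by
  have hS' := hS
  unfold spaceNeed at hS'
  refine Runs.seq (runs_parameters hσ C.size_pos hS rfl rfl rfl rfl) hσ fun σ₁ hf₁ fr₁ h₁ => ?_
  refine Runs.seq (runs_powers hf₁ h₁.reg14 (by omega)) hf₁ fun σ₂ hf₂ fr₂ h₂ => ?_
  have c₂ := h₁.of_frame fr₂ (by decide)
  refine Runs.assign_seq hf₂ (2 ^ colourCount k) ?_ ?_ fun hf₃ => ?_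
  · simp only [NExp.eval, c₂.reg5]
    have := colourCount_le_bitCount n k
    exact h₂ _ (by omega)
  · have := colourCount_le_bitCount n k
    exact Nat.pow_lt_pow_right (by norm_num) (by omega)
  have fr₃ := Frame.assign 12 (.const 0) σ₂ (2 ^ colourCount k)
  have e₃ : (σ₂.setReg 12 (2 ^ colourCount k)).reg 12 = 2 ^ colourCount k := by simp
  generalize σ₂.setReg 12 (2 ^ colourCount k) = σ₃ at *
  have c₃ := c₂.of_frame fr₃ (by decide)
  refine Runs.seq (runs_countTrials hf₃ c₃.reg4 (by omega)) hf₃ fun σ₄ hf₄ fr₄ h₄ => ?_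
  have c₄ := c₃.of_frame fr₄ (by decide)
  refine Runs.seq (runs_pascal hf₄ c₄.reg5 c₄.reg15 (by omega)) hf₄ fun σ₅ hf₅ fr₅ h₅ => ?_
  have c₅ := c₄.of_frame fr₅ (by decide)
  have ha : ∀ a < 3, σ₅.arr a = (initState C k ω).arr a := by
    intro a ha
    rw [fr₅.arr a (by interval_cases a <;> decide), fr₄.arr a (by interval_cases a <;> decide),
      fr₃.arr a (by interval_cases a <;> decide), fr₂.arr a (by interval_cases a <;> decide),
      fr₁.arr a (by interval_cases a <;> decide)]
  have hp : Prepared C k σ₅ := by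
    refine ⟨c₅.reg0, c₅.reg1, c₅.reg3, c₅.reg5, c₅.reg6, c₅.reg7, c₅.reg8, c₅.reg9, c₅.reg10,
      ?_, ?_, c₅.reg13, ?_, ?_, ?_, ?_, ?_, h₅⟩
    · rw [fr₅.reg _ (by decide), h₄]
    · rw [fr₅.reg _ (by decide), fr₄.reg _ (by decide), e₃]
    · intro p hp; rw [ha 0 (by omega)]; simp [initState, hp]
    · intro p hp; rw [ha 1 (by omega)]; simp [initState, hp]
    · intro p hp; rw [ha 2 (by omega)]; simp [initState, hp]
    · intro p hp
      rw [fr₅.farr _ (by decide), fr₄.farr _ (by decide), fr₃.farr _ (by decide),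
        fr₂.farr _ (by decide), fr₁.farr _ (by decide)]
      simp [initState, hp]
    · intro j hj
      rw [fr₅.arr _ (by decide), fr₄.arr _ (by decide), fr₃.arr _ (by decide)]
      exact h₂ j (by omega)
  have h20 : σ₅.reg 20 = 0 := by
    rw [fr₅.reg _ (by decide), fr₄.reg _ (by decide), fr₃.reg _ (by decide),
      fr₂.reg _ (by decide), fr₁.reg _ (by decide)]
    rfl
  have hcoins : σ₅.coins = ω := by
    rw [fr₅.coins (by decide), fr₄.coins (by decide), fr₃.coins (by decide),
      fr₂.coins (by decide), fr₁.coins (by decide)]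
    rfl
  refine Runs.seq (runs_trials hf₅ hp hS h20) hf₅ fun σ₆ hf₆ fr₆ h₆ => ?_
  rw [hcoins] at h₆
  exact Runs.assign hf₆ (σ₆.reg 20) rfl (hf₆.reg_lt _) (by simpa using h₆)

/-- The summand 3 covers the gate codes. -/
theorem initState_fits (C : Circuit F n) (k : ℕ) (ω : ℕ → Bool) (hS : n + k + C.size + 3 ≤ S) :
    (initState C k ω).Fits S := by
  have hlt : ∀ v ≤ S, v < 2 ^ S := fun v hv => hv.trans_lt Nat.lt_two_pow_self
  have ho := C.out.2
  refine ⟨fun x => hlt _ ?_, fun a p => hlt _ ?_, fun a p hp => ?_, fun a p hp => ?_⟩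
  · simp only [initState]; split <;> omega
  · simp only [initState]
    split_ifs with h
    · have hc : (C.gate ⟨p, h⟩).code ≤ S := by
        cases C.gate ⟨p, h⟩ <;> simp only [Gate.code] <;> omega
      have hl : (C.gate ⟨p, h⟩).left ≤ S := by
        cases C.gate ⟨p, h⟩ <;> simp only [Gate.left] <;> omega
      have hr : (C.gate ⟨p, h⟩).right ≤ S := by
        cases C.gate ⟨p, h⟩ <;> simp only [Gate.right] <;> omega
      split <;> omega
    · omega
  · simp [initState, show ¬ p < C.size by omega]
  · simp [initState, show ¬ p < C.size by omega]

end KMMD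

/-! ### Sieving for multilinear monomials -/

namespace KMMD

open Polynomial

/-- Distributivity: the numbers below `2 ^ m` enumerate the choices of one bit for each factor. -/
theorem sum_prod_binary {R : Type*} [CommRing R] (m : ℕ) (h : ℕ → ℕ → R) :
    ∑ T ∈ Finset.range (2 ^ m), ∏ c ∈ Finset.range m, h c (T / 2 ^ c % 2) =
      ∏ c ∈ Finset.range m, (h c 0 + h c 1) := by
  have : ∀ T : Fin (2 ^ m), ∏ c ∈ Finset.range m, h c (T / 2 ^ c % 2) =
      (fun g : Fin m → Fin 2 => ∏ c : Fin m, h c (g c)) (finFunctionFinEquiv.symm T) := by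
    intro T
    simp [Finset.prod_range]
  rw [Finset.sum_range, Finset.sum_congr rfl fun T _ => this T,
    Equiv.sum_comp finFunctionFinEquiv.symm (fun g : Fin m → Fin 2 => ∏ c : Fin m, h c (g c)),
    Finset.prod_range, ← Fintype.prod_sum (fun (c : Fin m) (j : Fin 2) => h c j)]
  simp

section

variable {F : Type*} [Field F] {n : ℕ}

/-- The sum is the coefficient of X^b in (1 + X)^|U| X^(m-|U|), the sign (-1)^m being 1. By `hc` the
power of X is at least b, so the coefficient is 0 unless m - |U| = b, and then it is the constant
term 1. -/
theorem sum_weight (m b : ℕ) (hm : Even m) (hb : b ≤ m) (U : Finset ℕ)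
    (hU : U ⊆ Finset.range m) (hc : U.card ≤ m - b) :
    ∑ T ∈ Finset.range (2 ^ m),
      (if ∀ c ∈ U, T / 2 ^ c % 2 = 1 then weight F b (popcount m T) else 0) =
      if U.card = m - b then 1 else 0 := by
  -- A colour in `T` contributes -(1 + X); a colour outside `T` contributes 1, or 0 if `U` requires
  -- it. For `T ⊇ U` the product is (-(1 + X))^|T|, whose coefficient at `b` is the weight.
  have key := congrArg (fun p : F[X] => p.coeff b) (sum_prod_binary m
    (fun c j => if j = 1 then -(1 + X : F[X]) else if c ∈ U then 0 else 1))
  simp only [finsetSum_coeff, zero_ne_one, if_false, if_true] at key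
  convert key using 1
  · refine Finset.sum_congr rfl fun T _ => ?_
    split_ifs with h
    · have : ∏ c ∈ Finset.range m, (if T / 2 ^ c % 2 = 1 then -(1 + X : F[X]) else
          if c ∈ U then 0 else 1) = ∏ c ∈ Finset.range m, (-(1 + X)) ^ (T / 2 ^ c % 2) := by
        refine Finset.prod_congr rfl fun c _ => ?_
        rcases Nat.mod_two_eq_zero_or_one (T / 2 ^ c) with h' | h'
        · have : c ∉ U := fun hcU => by simp [h c hcU] at h'
          simp [h', this]
        · simp [h']
      rw [this, Finset.prod_pow_eq_pow_sum, neg_pow]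
      have e : ((-1 : F[X]) ^ popcount m T) = C ((-1) ^ popcount m T) := by simp
      change _ = ((-1 : F[X]) ^ popcount m T * (1 + X) ^ popcount m T).coeff b
      rw [e, coeff_C_mul, coeff_one_add_X_pow]
      rfl
    · push Not at h
      obtain ⟨c, hcU, h⟩ := h
      rw [Finset.prod_eq_zero (hU hcU) (by simp [h, hcU])]
      simp
  · have : ∀ c ∈ Finset.range m, ((if c ∈ U then 0 else 1) + -(1 + X) : F[X]) =
        (-1) * (if c ∈ U then 1 + X else X) := by
      intro c _
      split_ifs <;> ring
    rw [Finset.prod_congr rfl this, Finset.prod_mul_distrib, Finset.prod_const,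
      Finset.card_range, hm.neg_one_pow, one_mul, Finset.prod_ite, Finset.prod_const,
      Finset.prod_const, Finset.filter_mem_eq_inter, Finset.inter_eq_right.2 hU]
    have hcard : (Finset.filter (fun c => c ∉ U) (Finset.range m)).card = m - U.card := by
      rw [← Finset.sdiff_eq_filter, Finset.card_sdiff_of_subset hU, Finset.card_range]
    rw [hcard, coeff_mul_X_pow']
    split_ifs with h₁ h₂ h₂
    · have : b - (m - U.card) = 0 := by omega
      rw [this, coeff_one_add_X_pow]; simp
    · omega
    · omega
    · rfl

/-- All variables of the monomial of degree `k` have different colours. -/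
def Colourful (k : ℕ) (col : ℕ → ℕ) (μ : Fin n →₀ ℕ) : Prop :=
  μ.degree = k ∧ (μ.support.image fun i : Fin n => col i).card = k

/-- Having `k` colours forces `k` variables, and degree `k` then leaves exponent 1 for each. -/
theorem Colourful.le_one {k : ℕ} {col : ℕ → ℕ} {μ : Fin n →₀ ℕ} (h : Colourful k col μ)
    (i : Fin n) : μ i ≤ 1 := by
  have h1 : k ≤ μ.support.card := h.2 ▸ Finset.card_image_le
  have h2 : ∑ i ∈ μ.support, μ i = k := h.1
  by_contra! hi
  have hmem : i ∈ μ.support := by rw [Finsupp.mem_support_iff]; omega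
  have : ∑ i ∈ μ.support, 1 < ∑ i ∈ μ.support, μ i :=
    Finset.sum_lt_sum (fun j hj => Nat.one_le_iff_ne_zero.2 (Finsupp.mem_support_iff.1 hj))
      ⟨i, hmem, hi⟩
  simp at this
  omega

open Classical in
/-- The colourful part of `f`. -/
noncomputable def colourfulPart (k : ℕ) (f : MvPolynomial (Fin n) F) (col : ℕ → ℕ) :
    MvPolynomial (Fin n) F[X] :=
  ∑ μ ∈ f.support with Colourful k col μ, MvPolynomial.monomial μ (C (f.coeff μ))

theorem eval_colourfulPart (k : ℕ) (f : MvPolynomial (Fin n) F) (col ex : ℕ → ℕ) :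
    MvPolynomial.eval (fun i : Fin n => (X : F[X]) ^ ex i) (colourfulPart k f col) =
      open Classical in
      ∑ μ ∈ f.support with Colourful k col μ, C (f.coeff μ) * X ^ (∑ i, μ i * ex i) := by
  classical
  simp only [colourfulPart, map_sum, MvPolynomial.eval_monomial]
  refine Finset.sum_congr rfl fun μ _ => ?_
  rw [Finsupp.prod_fintype _ _ (by simp)]
  simp_rw [← pow_mul, Finset.prod_pow_eq_pow_sum, mul_comm]

/-- A single absent colour kills the monomial; otherwise the multiple of `E` records its degree and
the remaining sum its random exponents. -/
theorem prod_point (E : ℕ) (col ex : ℕ → ℕ) (T : ℕ) (μ : Fin n →₀ ℕ) :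
    ∏ i, point F n E col ex T i ^ μ i =
      if ∀ c ∈ μ.support.image (fun i : Fin n => col i), T / 2 ^ c % 2 = 1 then
        X ^ (μ.degree * E + ∑ i, μ i * ex i) else 0 := by
  split_ifs with h
  · simp only [Finset.mem_image, forall_exists_index, and_imp, forall_apply_eq_imp_iff₂] at h
    have : ∀ i, point F n E col ex T i ^ μ i = X ^ (μ i * (E + ex i)) := by
      intro i
      by_cases hi : i ∈ μ.support
      · rw [point, if_pos (h i hi), ← pow_mul, mul_comm]
      · simp [Finsupp.notMem_support_iff.1 hi]
    rw [Finset.prod_congr rfl fun i _ => this i, Finset.prod_pow_eq_pow_sum]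
    simp_rw [mul_add, Finset.sum_add_distrib, ← Finset.sum_mul]
    rw [Finsupp.degree_eq_sum]
  · push Not at h
    obtain ⟨c, hc, h⟩ := h
    obtain ⟨i, hi, rfl⟩ := Finset.mem_image.1 hc
    refine Finset.prod_eq_zero (Finset.mem_univ i) ?_
    rw [point, if_neg h, zero_pow (Finsupp.mem_support_iff.1 hi)]

theorem sum_exponents_lt {k : ℕ} {ex : ℕ → ℕ} (hex : ∀ i, ex i < exponentCount k)
    {μ : Fin n →₀ ℕ} (hμ : μ.degree ≤ k) : ∑ i, μ i * ex i < shift k := by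
  refine Nat.lt_succ_of_le ?_
  calc ∑ i, μ i * ex i ≤ ∑ i, μ i * exponentCount k :=
        Finset.sum_le_sum fun i _ => Nat.mul_le_mul_left _ (hex i).le
    _ = μ.degree * exponentCount k := by rw [← Finset.sum_mul, Finsupp.degree_eq_sum]
    _ ≤ _ := Nat.mul_le_mul_right _ hμ

/-- Writing E for `shift k`, monomials of degree below `k` end before kE because their exponent sums
are less than E, and those of degree above `k` start at (k + 1)E or later. -/
theorem exponent_eq_iff {k d : ℕ} {ex : ℕ → ℕ} (hex : ∀ i, ex i < exponentCount k)
    (hd : d < shift k) (μ : Fin n →₀ ℕ) :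
    k * shift k + d = μ.degree * shift k + ∑ i, μ i * ex i ↔
      μ.degree = k ∧ d = ∑ i, μ i * ex i := by
  refine ⟨fun h => ?_, fun ⟨h₁, h₂⟩ => by rw [h₁, h₂]⟩
  rcases lt_trichotomy μ.degree k with hlt | heq | hgt
  · have := sum_exponents_lt hex hlt.le
    have : (μ.degree + 1) * shift k ≤ k * shift k := Nat.mul_le_mul_right _ hlt
    nlinarith
  · rw [heq] at h
    exact ⟨heq, by omega⟩
  · have : (k + 1) * shift k ≤ μ.degree * shift k := Nat.mul_le_mul_right _ hgt
    rw [Nat.succ_mul] at this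
    omega

/-- After exchanging the sums, the sides agree monomial by monomial: a wrong exponent gives 0 on
both, and for a right one the weights add up to the indicator of colourfulness by `sum_weight`. -/
theorem sievedCoeff_eq (k : ℕ) (f : MvPolynomial (Fin n) F) {col ex : ℕ → ℕ}
    (hcol : ∀ i, col i < colourCount k) (hex : ∀ i, ex i < exponentCount k) {d : ℕ}
    (hd : d < shift k) :
    sievedCoeff k f col ex d = (MvPolynomial.eval (fun i : Fin n => (X : F[X]) ^ ex i)
      (colourfulPart k f col)).coeff d := by
  classical
  have hk := le_colourCount k
  rw [eval_colourfulPart, finsetSum_coeff, Finset.sum_filter]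
  simp only [sievedCoeff, MvPolynomial.aeval_def, MvPolynomial.eval₂_eq', finsetSum_coeff,
    Finset.mul_sum]
  rw [Finset.sum_comm]
  refine Finset.sum_congr rfl fun μ _ => ?_
  simp only [prod_point, Polynomial.algebraMap_apply, Algebra.algebraMap_self, RingHom.id_apply,
    coeff_C_mul]
  by_cases hμ : k * shift k + d = μ.degree * shift k + ∑ i, μ i * ex i
  · obtain ⟨h₁, h₂⟩ := (exponent_eq_iff hex hd μ).1 hμ
    set U := μ.support.image fun i : Fin n => col i
    have hU : U ⊆ Finset.range (colourCount k) := by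
      intro c hc
      obtain ⟨i, -, rfl⟩ := Finset.mem_image.1 hc
      simpa using hcol i
    have hUk : U.card ≤ k := by
      refine Finset.card_image_le.trans ?_
      rw [← h₁, Finset.card_eq_sum_ones]
      exact Finset.sum_le_sum fun i hi => Nat.one_le_iff_ne_zero.2 (Finsupp.mem_support_iff.1 hi)
    have hsum := sum_weight (F := F) (colourCount k) (colourCount k - k)
      ⟨2 * blockCount k, by unfold colourCount; ring⟩ (by omega) U hU (by omega)
    rw [show colourCount k - (colourCount k - k) = k by omega] at hsum
    have : ∀ T ∈ Finset.range (2 ^ colourCount k),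
        weight F (colourCount k - k) (popcount (colourCount k) T) * (f.coeff μ *
          (if ∀ c ∈ U, T / 2 ^ c % 2 = 1 then (X : F[X]) ^ (μ.degree * shift k + ∑ i, μ i * ex i)
            else 0).coeff (k * shift k + d)) =
        (if ∀ c ∈ U, T / 2 ^ c % 2 = 1 then
          weight F (colourCount k - k) (popcount (colourCount k) T) else 0) * f.coeff μ := by
      intro T _
      split_ifs
      · rw [hμ, coeff_X_pow_self]; ring
      · simp
    rw [Finset.sum_congr rfl this, ← Finset.sum_mul, hsum]
    have hiff : Colourful k col μ ↔ U.card = k := ⟨fun h => h.2, fun h => ⟨h₁, h⟩⟩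
    simp only [hiff]
    split_ifs
    · rw [← h₂, coeff_X_pow_self]; ring
    · simp
  · rw [Finset.sum_eq_zero]
    · split_ifs with h
      · rw [coeff_X_pow, if_neg, mul_zero]
        exact fun h' => hμ ((exponent_eq_iff hex hd μ).2 ⟨h.1, h'⟩)
      · rfl
    · intro T _
      split_ifs
      · rw [coeff_X_pow, if_neg hμ]; simp
      · simp

/-- All exponents in the evaluated colourful part are below `shift k`, so the tested coefficients
detect every nonzero value. -/
theorem hit_iff (k : ℕ) (f : MvPolynomial (Fin n) F) {col ex : ℕ → ℕ}
    (hcol : ∀ i, col i < colourCount k) (hex : ∀ i, ex i < exponentCount k) :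
    Hit k f col ex ↔ MvPolynomial.eval (fun i : Fin n => (X : F[X]) ^ ex i)
      (colourfulPart k f col) ≠ 0 := by
  classical
  constructor
  · rintro ⟨d, hd, h⟩ h0
    rw [sievedCoeff_eq k f hcol hex hd, h0] at h
    simp at h
  · intro h
    by_contra hn
    refine h (Polynomial.ext fun d => ?_)
    rcases lt_or_ge d (shift k) with hd | hd
    · rw [← sievedCoeff_eq k f hcol hex hd]
      by_contra h'
      exact hn ⟨d, hd, by simpa using h'⟩
    · rw [eval_colourfulPart, finsetSum_coeff]
      simp only [coeff_zero]
      refine Finset.sum_eq_zero fun μ hμ => ?_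
      have := sum_exponents_lt hex (Finset.mem_filter.1 hμ).2.1.le
      rw [coeff_C_mul, coeff_X_pow, if_neg (by omega), mul_zero]

theorem Hit.hasMultilinearMonomial {k : ℕ} {f : MvPolynomial (Fin n) F} {col ex : ℕ → ℕ}
    (hcol : ∀ i, col i < colourCount k) (hex : ∀ i, ex i < exponentCount k)
    (h : Hit k f col ex) : HasMultilinearMonomial k f := by
  classical
  rw [hit_iff k f hcol hex, eval_colourfulPart] at h
  obtain ⟨μ, hμ, -⟩ := Finset.exists_ne_zero_of_sum_ne_zero h
  rw [Finset.mem_filter] at hμ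
  exact ⟨μ, hμ.2.le_one, hμ.2.1, MvPolynomial.mem_support_iff.1 hμ.1⟩

theorem TrialHits.hasMultilinearMonomial {k τ : ℕ} {f : MvPolynomial (Fin n) F} {ω : ℕ → Bool}
    (h : TrialHits k f ω τ) : HasMultilinearMonomial k f :=
  Hit.hasMultilinearMonomial (drawnColour_lt n k _) (drawnExponent_lt n k _) h

end

end KMMD

/-! ### The probability that a trial succeeds -/

namespace KMMD

open Polynomial

section Counting

/-- Among the `L`-bit numbers, every residue modulo `M` is attained at least `2 ^ L / M` times. -/
theorem card_residue_ge (L M r : ℕ) (hr : r < M) :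
    2 ^ L / M ≤ (Finset.univ.filter fun x : Fin L → Bool =>
      (∑ j : Fin L, (x j).toNat * 2 ^ (j : ℕ)) % M = r).card := by
  classical
  let e : (Fin L → Bool) ≃ Fin (2 ^ L) :=
    (Equiv.arrowCongr (Equiv.refl _) finTwoEquiv.symm).trans finFunctionFinEquiv
  have he : ∀ x, (e x : ℕ) = ∑ j : Fin L, (x j).toNat * 2 ^ (j : ℕ) := by
    intro x
    simp only [e, Equiv.trans_apply, finFunctionFinEquiv_apply]
    refine Finset.sum_congr rfl fun j _ => ?_
    congr 1
    cases h : x j <;> simp [h, finTwoEquiv]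
  have hlt : ∀ t : Fin (2 ^ L / M), r + M * t < 2 ^ L := by
    intro t
    have h1 : M * (t + 1) ≤ M * (2 ^ L / M) := Nat.mul_le_mul_left _ t.2
    have h2 := Nat.mul_div_le (2 ^ L) M
    rw [Nat.mul_succ] at h1
    omega
  have hinj : Function.Injective fun t : Fin (2 ^ L / M) => e.symm ⟨r + M * t, hlt t⟩ := by
    intro t t' h
    have h := e.symm.injective h
    simp only [Fin.mk.injEq] at h
    exact Fin.ext (Nat.eq_of_mul_eq_mul_left (show 0 < M by omega) (by omega))
  calc 2 ^ L / M = (Finset.univ.image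
        fun t : Fin (2 ^ L / M) => e.symm ⟨r + M * t, hlt t⟩).card := by
        rw [Finset.card_image_of_injective _ hinj]; simp
    _ ≤ _ := by
        refine Finset.card_le_card fun x hx => ?_
        obtain ⟨t, -, rfl⟩ := Finset.mem_image.1 hx
        simp only [Finset.mem_filter, Finset.mem_univ, true_and]
        rw [← he, Equiv.apply_symm_apply, Nat.add_mul_mod_self_left, Nat.mod_eq_of_lt hr]

/-- The residues modulo `M` of `n` numbers with `L` bits each. -/
def residues {n L : ℕ} (M : ℕ) (hM : 0 < M) (b : Fin n → Fin L → Bool) (i : Fin n) : Fin M :=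
  ⟨(∑ j : Fin L, (b i j).toNat * 2 ^ (j : ℕ)) % M, Nat.mod_lt _ hM⟩

/-- The fibre over each tuple contains a product of `n` residue classes, each bounded by
`card_residue_ge`. -/
theorem card_residues_ge {n L M : ℕ} (hM : 0 < M) (G : Finset (Fin n → Fin M)) :
    G.card * (2 ^ L / M) ^ n ≤ (Finset.univ.filter fun b : Fin n → Fin L → Bool =>
      residues M hM b ∈ G).card := by
  classical
  rw [Finset.card_eq_sum_card_fiberwise (f := residues M hM) (t := G)
    (s := Finset.univ.filter fun b : Fin n → Fin L → Bool => residues M hM b ∈ G)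
    (fun b hb => by simpa using hb)]
  rw [← smul_eq_mul, ← Finset.sum_const]
  refine Finset.sum_le_sum fun v hv => ?_
  calc (2 ^ L / M) ^ n = ∏ _i : Fin n, 2 ^ L / M := by simp
    _ ≤ ∏ i : Fin n, (Finset.univ.filter fun x : Fin L → Bool =>
      (∑ j : Fin L, (x j).toNat * 2 ^ (j : ℕ)) % M = v i).card :=
        Finset.prod_le_prod' fun i _ => card_residue_ge L M _ (v i).2
    _ = (Fintype.piFinset fun i : Fin n => Finset.univ.filter fun x : Fin L → Bool =>
      (∑ j : Fin L, (x j).toNat * 2 ^ (j : ℕ)) % M = v i).card := by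
        rw [Fintype.card_piFinset]
    _ ≤ _ := by
        refine Finset.card_le_card fun b hb => ?_
        have h : residues M hM b = v := by
          funext i
          have := Fintype.mem_piFinset.1 hb i
          exact Fin.ext (Finset.mem_filter.1 this).2
        simp [h, hv]

/-- The number of functions that are injective on a given set. -/
theorem card_injOn (n m : ℕ) (U : Finset (Fin n)) :
    (Finset.univ.filter fun χ : Fin n → Fin m => Set.InjOn χ U).card =
      m.descFactorial U.card * m ^ (n - U.card) := by
  classical
  let e := Equiv.piEquivPiSubtypeProd (fun i : Fin n => i ∈ U) (fun _ => Fin m)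
  have h1 : (Finset.univ.filter fun χ : Fin n → Fin m => Set.InjOn χ U).card =
      (Finset.univ.filter fun p : ({i // i ∈ U} → Fin m) × ({i // i ∉ U} → Fin m) =>
        Function.Injective p.1).card := by
    refine Finset.card_equiv e fun χ => ?_
    simp only [Finset.mem_filter, Finset.mem_univ, true_and]
    exact Set.injOn_iff_injective
  have h2 : (Finset.univ.filter fun p : ({i // i ∈ U} → Fin m) × ({i // i ∉ U} → Fin m) =>
        Function.Injective p.1) =
      (Finset.univ.filter fun p : {i // i ∈ U} → Fin m => Function.Injective p) ×ˢ
        Finset.univ := by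
    ext p; simp
  have h3 : (Finset.univ.filter fun p : {i // i ∈ U} → Fin m => Function.Injective p).card =
      m.descFactorial U.card := by
    rw [← Fintype.card_subtype, Fintype.card_congr (Equiv.subtypeInjectiveEquivEmbedding _ _),
      Fintype.card_embedding_eq]
    simp
  rw [h1, h2, Finset.card_product, h3]
  simp [Fintype.card_subtype_compl]

end Counting

/-! ### Colourings and exponents that make a trial succeed -/

section

variable {F : Type*} [Field F] {n : ℕ}

/-- Schwartz–Zippel over F[X]. Powers of X are distinct for degree reasons, so the sample set is
large enough even over a small finite field, and the ratio of degree to sample size is at most 1/2.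
-/
theorem card_nonzero_ge (k : ℕ) (p : MvPolynomial (Fin n) F[X]) (hp : p ≠ 0)
    (hdeg : p.totalDegree ≤ k) {A : ℕ} (hA : 2 * k ≤ A) (hA0 : 0 < A) :
    (A : ℝ) ^ n / 2 ≤ (open Classical in Finset.univ.filter fun a : Fin n → Fin A =>
      MvPolynomial.eval (fun i => (X : F[X]) ^ (a i : ℕ)) p ≠ 0).card := by
  classical
  set Z := Finset.univ.filter fun a : Fin n → Fin A =>
      MvPolynomial.eval (fun i => (X : F[X]) ^ (a i : ℕ)) p = 0 with hZ
  have hinj : Function.Injective fun a : Fin A => (X : F[X]) ^ (a : ℕ) := by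
    intro a b h
    have := congrArg Polynomial.natDegree h
    simpa [Fin.ext_iff] using this
  set S : Finset F[X] := Finset.univ.image fun a : Fin A => (X : F[X]) ^ (a : ℕ) with hS
  have hSc : S.card = A := by rw [hS, Finset.card_image_of_injective _ hinj]; simp
  have sz := MvPolynomial.schwartz_zippel_totalDegree hp S
  rw [hSc] at sz
  have hZle : Z.card ≤ (Finset.filter (fun x => MvPolynomial.eval x p = 0)
      (Fintype.piFinset fun _ : Fin n => S)).card := by
    refine Finset.card_le_card_of_injOn (fun a i => (X : F[X]) ^ (a i : ℕ)) ?_ ?_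
    · intro a ha
      simp only [Finset.coe_filter, Set.mem_ofPred_eq, Fintype.mem_piFinset]
      exact ⟨fun i => Finset.mem_image_of_mem _ (Finset.mem_univ _), (Finset.mem_filter.1 ha).2⟩
    · intro a _ b _ h
      funext i
      exact hinj (congrFun h i)
  have hAn : (0 : ℝ) < (A : ℝ) ^ n := by positivity
  have h1 : (Z.card : ℝ) / (A : ℝ) ^ n ≤ (p.totalDegree : ℝ) / A := by
    have : (((Finset.filter (fun x => MvPolynomial.eval x p = 0)
      (Fintype.piFinset fun _ : Fin n => S)).card : ℝ)) / (A : ℝ) ^ n ≤ (p.totalDegree : ℝ) / A := by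
      have sz' := (NNRat.cast_le (K := ℝ)).2 sz
      push_cast at sz'
      exact sz'
    refine le_trans ?_ this
    gcongr
  have h2 : (p.totalDegree : ℝ) / A ≤ 1 / 2 := by
    rw [div_le_div_iff₀ (by positivity) (by norm_num)]
    have : (p.totalDegree : ℝ) ≤ k := by exact_mod_cast hdeg
    have : (2 * k : ℝ) ≤ A := by exact_mod_cast hA
    linarith
  have h3 : (Z.card : ℝ) ≤ (A : ℝ) ^ n / 2 := by
    have := h1.trans h2
    rw [div_le_iff₀ hAn] at this
    linarith
  have h4 := Finset.card_filter_add_card_filter_not (s := (Finset.univ : Finset (Fin n → Fin A)))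
    (fun a => MvPolynomial.eval (fun i => (X : F[X]) ^ (a i : ℕ)) p = 0)
  rw [Finset.card_univ, Fintype.card_fun, Fintype.card_fin, Fintype.card_fin] at h4
  have h5 : (Z.card : ℝ) + ((Finset.univ.filter fun a : Fin n → Fin A =>
      MvPolynomial.eval (fun i => (X : F[X]) ^ (a i : ℕ)) p ≠ 0).card : ℝ) = (A : ℝ) ^ n := by
    exact_mod_cast h4
  linarith

theorem colourfulPart_ne_zero {k : ℕ} {f : MvPolynomial (Fin n) F} {col : ℕ → ℕ}
    {μ : Fin n →₀ ℕ} (hμ : f.coeff μ ≠ 0) (h : Colourful k col μ) : colourfulPart k f col ≠ 0 := by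
  classical
  intro h0
  have := congrArg (MvPolynomial.coeff μ) h0
  simp only [colourfulPart, MvPolynomial.coeff_sum, MvPolynomial.coeff_monomial,
    MvPolynomial.coeff_zero] at this
  rw [Finset.sum_ite_eq' , if_pos (Finset.mem_filter.2 ⟨MvPolynomial.mem_support_iff.2 hμ, h⟩)]
    at this
  exact hμ (by simpa using this)

theorem totalDegree_colourfulPart_le (k : ℕ) (f : MvPolynomial (Fin n) F) (col : ℕ → ℕ) :
    (colourfulPart k f col).totalDegree ≤ k := by
  classical
  refine MvPolynomial.totalDegree_finsetSum_le fun μ hμ => ?_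
  refine (MvPolynomial.totalDegree_monomial_le _ _).trans ?_
  exact (Finset.mem_filter.1 hμ).2.1.le

theorem colourful_of_injOn {k m : ℕ} {μ : Fin n →₀ ℕ} (h1 : ∀ i, μ i ≤ 1) (h2 : μ.degree = k)
    {col : ℕ → ℕ} {χ : Fin n → Fin m} (hχ : Set.InjOn χ μ.support) (hcol : ∀ i : Fin n, col i = χ i) :
    Colourful k col μ ∧ μ.support.card = k := by
  classical
  have hc : μ.support.card = k := by
    rw [← h2, Finset.card_eq_sum_ones]
    refine Finset.sum_congr rfl fun i hi => ?_
    have := Finsupp.mem_support_iff.1 hi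
    have := h1 i
    omega
  refine ⟨⟨h2, ?_⟩, hc⟩
  rw [Finset.card_image_of_injOn, hc]
  intro i hi j hj h
  exact hχ hi hj (Fin.ext (by simpa [hcol] using h))

theorem Hit.congr {k : ℕ} {f : MvPolynomial (Fin n) F} {col ex col' ex' : ℕ → ℕ}
    (hc : ∀ i : Fin n, col i = col' i) (he : ∀ i : Fin n, ex i = ex' i) :
    Hit k f col ex ↔ Hit k f col' ex' := by
  have : ∀ T, point F n (shift k) col ex T = point F n (shift k) col' ex' T := by
    intro T; funext i; simp [point, hc, he]
  simp only [Hit, sievedCoeff, this]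

/-- Extension of a finite sequence by zeros. -/
def extend {n : ℕ} (g : Fin n → ℕ) (i : ℕ) : ℕ := if h : i < n then g ⟨i, h⟩ else 0

theorem extend_apply {n : ℕ} (g : Fin n → ℕ) (i : Fin n) : extend g i = g i := by
  simp [extend]

theorem extend_lt {n m : ℕ} (hm : 0 < m) {g : Fin n → ℕ} (hg : ∀ i, g i < m) (i : ℕ) :
    extend g i < m := by
  unfold extend; split_ifs
  · exact hg _
  · exact hm

/-- The pairs of colours and exponents make the trial succeed. -/
def Good (k : ℕ) (f : MvPolynomial (Fin n) F) (v : Fin n → Fin (pairCount k)) : Prop :=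
  Hit k f (extend fun i => v i % colourCount k) (extend fun i => v i / colourCount k)

/-- A colouring that is injective on the support of the monomial makes the colourful part nonzero,
and then at least half of the exponent vectors work. The good exponents depend on the colouring,
whence the sigma type in the count. -/
theorem card_good_ge (k : ℕ) (f : MvPolynomial (Fin n) F) (h : HasMultilinearMonomial k f) :
    k ≤ n ∧ ((colourCount k).descFactorial k * (colourCount k : ℝ) ^ (n - k)) *
      ((exponentCount k : ℝ) ^ n / 2) ≤
      (open Classical in Finset.univ.filter fun v : Fin n → Fin (pairCount k) =>
        Good k f v).card := by
  classical
  obtain ⟨μ, h1, h2, h3⟩ := h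
  have hc : μ.support.card = k := by
    rw [← h2, Finset.card_eq_sum_ones]
    refine Finset.sum_congr rfl fun i hi => ?_
    have := Finsupp.mem_support_iff.1 hi
    have := h1 i
    omega
  refine ⟨by rw [← hc]; simpa using Finset.card_le_univ μ.support, ?_⟩
  set m := colourCount k with hm
  set A := exponentCount k with hA
  have hm0 : 0 < m := colourCount_pos k
  have hA0 : 0 < A := exponentCount_pos k
  have hlt : ∀ (c : Fin m) (a : Fin A), (c : ℕ) + m * a < pairCount k := by
    intro c a
    have : m * (a + 1) ≤ m * A := Nat.mul_le_mul_left _ a.2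
    have := c.2
    change _ < m * A
    rw [Nat.mul_succ] at *
    omega
  -- Inverse to the decoding by remainder and quotient modulo `m`.
  let Φ : (Fin n → Fin m) × (Fin n → Fin A) → (Fin n → Fin (pairCount k)) :=
    fun p i => ⟨p.1 i + m * p.2 i, hlt _ _⟩
  have hmod : ∀ p i, (Φ p i : ℕ) % m = p.1 i := by
    intro p i
    simp [Φ, Nat.add_mul_mod_self_left, Nat.mod_eq_of_lt (p.1 i).2]
  have hdiv : ∀ p i, (Φ p i : ℕ) / m = p.2 i := by
    intro p i
    simp [Φ, Nat.add_mul_div_left _ _ hm0, Nat.div_eq_of_lt (p.1 i).2]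
  have hΦ : Function.Injective Φ := by
    intro p p' h
    refine Prod.ext (funext fun i => Fin.ext ?_) (funext fun i => Fin.ext ?_)
    · rw [← hmod, ← hmod, h]
    · rw [← hdiv, ← hdiv, h]
  let B : (Fin n → Fin m) → Finset (Fin n → Fin A) := fun χ =>
    Finset.univ.filter fun a => MvPolynomial.eval (fun i => (X : F[X]) ^ (a i : ℕ))
      (colourfulPart k f (extend fun i => χ i)) ≠ 0
  let I := Finset.univ.filter fun χ : Fin n → Fin m => Set.InjOn χ μ.support
  have hcard : (I.sigma B).card ≤ (Finset.univ.filter fun v : Fin n → Fin (pairCount k) =>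
        Good k f v).card := by
    refine Finset.card_le_card_of_injOn (fun s => Φ (s.1, s.2)) ?_ ?_
    · rintro ⟨χ, a⟩ hs
      have hs := (Finset.mem_filter.1 (Finset.mem_sigma.1 hs).2).2
      refine Finset.mem_coe.2 (Finset.mem_filter.2 ⟨Finset.mem_univ _, ?_⟩)
      unfold Good
      simp only [← hm, hmod, hdiv]
      rw [hit_iff k f (extend_lt hm0 fun i => (χ i).2) (extend_lt hA0 fun i => (a i).2)]
      simpa only [extend_apply] using hs
    · rintro ⟨χ, a⟩ _ ⟨χ', a'⟩ _ h
      have := hΦ h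
      simp only [Prod.mk.injEq] at this
      rw [this.1, this.2]
  have hB : ∀ χ ∈ I, (A : ℝ) ^ n / 2 ≤ (B χ).card := by
    intro χ hχ
    have hcf := colourful_of_injOn h1 h2 (Finset.mem_filter.1 hχ).2
      (extend_apply fun i => (χ i : ℕ))
    exact card_nonzero_ge k _ (colourfulPart_ne_zero h3 hcf.1)
      (totalDegree_colourfulPart_le k f _)
      (by have := le_three_blockCount k; rw [hA]; unfold exponentCount; omega) hA0
  have hI : I.card = m.descFactorial k * m ^ (n - k) := by
    rw [card_injOn n m μ.support, hc]
  calc _ = (I.card : ℝ) * ((A : ℝ) ^ n / 2) := by rw [hI]; push_cast; ring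
    _ = ∑ χ ∈ I, ((A : ℝ) ^ n / 2) := by rw [Finset.sum_const, nsmul_eq_mul]
    _ ≤ ∑ χ ∈ I, ((B χ).card : ℝ) := Finset.sum_le_sum hB
    _ = ((I.sigma B).card : ℝ) := by rw [Finset.card_sigma]; push_cast; rfl
    _ ≤ _ := by exact_mod_cast hcard

end

/-! Estimates. -/

/-- Stirling's sequence decreases from its value e/√2 at 1, which gives the bound with √n; this is
weakened to n. -/
theorem factorial_le_exp (n : ℕ) (hn : 0 < n) :
    (n.factorial : ℝ) ≤ Real.exp 1 * n * (n / Real.exp 1) ^ n := by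
  obtain ⟨n, rfl⟩ : ∃ j, n = j + 1 := ⟨n - 1, by omega⟩
  have h := Stirling.stirlingSeq'_antitone (Nat.zero_le n)
  simp only [Function.comp_apply, Nat.succ_eq_add_one, zero_add, Stirling.stirlingSeq_one] at h
  rw [Stirling.stirlingSeq, div_le_div_iff₀ (by positivity) (by positivity)] at h
  have h2 : √2 ≠ 0 := by positivity
  have h3 : ((n + 1).factorial : ℝ) ≤
      Real.exp 1 * √((n + 1 : ℕ) : ℝ) * (((n + 1 : ℕ) : ℝ) / Real.exp 1) ^ (n + 1) := by
    refine le_of_mul_le_mul_right (h.trans_eq ?_) (show 0 < √2 by positivity)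
    rw [Real.sqrt_mul (by norm_num)]
    ring
  have h4 : √((n + 1 : ℕ) : ℝ) ≤ ((n + 1 : ℕ) : ℝ) :=
    Real.sqrt_le_iff.2 ⟨by positivity, by push_cast; nlinarith [(Nat.cast_nonneg n : (0 : ℝ) ≤ n)]⟩
  refine h3.trans ?_
  gcongr

/-- One term of the exponential series: nⁿ/n! ≤ eⁿ. -/
theorem factorial_ge_exp (n : ℕ) : ((n : ℝ) / Real.exp 1) ^ n ≤ n.factorial := by
  rw [div_pow, div_le_iff₀ (by positivity), ← Real.exp_nat_mul, mul_one, ← div_le_iff₀'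
    (by positivity)]
  exact Real.pow_div_factorial_le_exp (n : ℝ) (by positivity) n

/-- The descending factorial is (4q)!/q!. The two factorial bounds reduce the quotient to
(4/e³)^q/(eq), and e³/4 ≈ 5.0214. -/
theorem descFactorial_ge_block (q : ℕ) (hq : 0 < q) :
    1 / (3 * q * 5.03 ^ q) ≤ ((4 * q).descFactorial (3 * q) : ℝ) / ((4 * q : ℕ) : ℝ) ^ (3 * q) := by
  have he3 : Real.exp 1 ≤ 3 := by linarith [Real.exp_one_lt_d9]
  have hq0 : (0 : ℝ) < q := by exact_mod_cast hq
  have e0 := Real.exp_pos 1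
  have h1 := Nat.factorial_mul_descFactorial (show 3 * q ≤ 4 * q by omega)
  rw [show 4 * q - 3 * q = q by omega] at h1
  have h2 := factorial_ge_exp (4 * q)
  have h3 := factorial_le_exp q hq
  rw [← h1] at h2
  push_cast at h2 ⊢
  have h5 : (Real.exp 1 ^ 3 / 4) ^ q ≤ (5.03 : ℝ) ^ q := by
    gcongr
    have : Real.exp 1 ^ 3 ≤ 2.7182818286 ^ 3 := by
      gcongr
      exact Real.exp_one_lt_d9.le
    norm_num at this ⊢
    linarith
  have h6 : (4 * (q : ℝ) / Real.exp 1) ^ (4 * q) ≤ Real.exp 1 * q * (q / Real.exp 1) ^ q *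
      (4 * q).descFactorial (3 * q) := h2.trans (by gcongr)
  rw [div_le_div_iff₀ (by positivity) (by positivity), one_mul]
  have h7 : (4 * (q : ℝ) / Real.exp 1) ^ (4 * q) * (Real.exp 1 ^ 3 / 4) ^ q =
      (4 * (q : ℝ)) ^ (3 * q) * (q / Real.exp 1) ^ q := by
    rw [pow_mul, pow_mul, ← mul_pow, ← mul_pow]
    congr 1
    field_simp
  have h8 : (0 : ℝ) < (q / Real.exp 1) ^ q := by positivity
  refine le_of_mul_le_mul_right ?_ h8
  rw [← h7]
  calc _ ≤ (Real.exp 1 * q * (q / Real.exp 1) ^ q *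
      (4 * q).descFactorial (3 * q)) * (5.03 : ℝ) ^ q := by gcongr
    _ ≤ (3 * q * (q / Real.exp 1) ^ q * (4 * q).descFactorial (3 * q)) * (5.03 : ℝ) ^ q := by
        gcongr
    _ = _ := by ring

/-- Each further factor (m - k)/m is at most 1. This permits replacing `k` by the multiple of three
above it. -/
theorem descFactorial_div_pow_anti {m j k : ℕ} (hjk : j ≤ k) (hm : 0 < m) :
    (m.descFactorial k : ℝ) / (m : ℝ) ^ k ≤ (m.descFactorial j : ℝ) / (m : ℝ) ^ j := by
  induction k, hjk using Nat.le_induction with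
  | base => exact le_rfl
  | succ k _ ih =>
    refine le_trans ?_ ih
    rw [Nat.descFactorial_succ, pow_succ, div_le_div_iff₀ (by positivity) (by positivity)]
    have : ((m - k : ℕ) : ℝ) ≤ m := by exact_mod_cast Nat.sub_le m k
    push_cast
    calc ((m - k : ℕ) : ℝ) * (m.descFactorial k) * (m : ℝ) ^ k ≤
        (m : ℝ) * (m.descFactorial k) * (m : ℝ) ^ k := by gcongr
      _ = _ := by ring

theorem descFactorial_ge (k : ℕ) :
    1 / (3 * blockCount k * 5.03 ^ blockCount k) ≤
      ((colourCount k).descFactorial k : ℝ) / (colourCount k : ℝ) ^ k :=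
  (descFactorial_ge_block _ (blockCount_pos k)).trans
    (descFactorial_div_pow_anti (le_three_blockCount k) (colourCount_pos k))

/-- The base is at least 1 - x with x = M/2^(n+M). Since nx ≤ 1/2, Bernoulli's inequality gives the
claim; this is why `n + M` bits are drawn. -/
theorem half_le_bias_pow (n M : ℕ) (hM : 0 < M) :
    1 / 2 ≤ ((M : ℝ) * ((2 ^ (n + M) / M : ℕ) : ℝ) / 2 ^ (n + M)) ^ n := by
  have h1 : (n : ℝ) + 1 ≤ 2 ^ n := by exact_mod_cast Nat.lt_two_pow_self
  have h2 : (2 * M : ℝ) ≤ 2 ^ M := by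
    have : 2 * M ≤ 2 ^ M := by
      obtain ⟨j, rfl⟩ : ∃ j, M = j + 1 := ⟨M - 1, by omega⟩
      have := @Nat.lt_two_pow_self j
      rw [pow_succ]; omega
    exact_mod_cast this
  have hP : (0 : ℝ) < 2 ^ (n + M) := by positivity
  have hM' : (0 : ℝ) < M := by exact_mod_cast hM
  have h3 : 2 * n * (M : ℝ) ≤ 2 ^ (n + M) := by
    rw [pow_add]
    calc 2 * n * (M : ℝ) ≤ ((n : ℝ) + 1) * (2 * M) := by nlinarith
      _ ≤ _ := by gcongr
  have h4 : (2 : ℝ) ^ (n + M) - M ≤ (M : ℝ) * ((2 ^ (n + M) / M : ℕ) : ℝ) := by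
    have h := Nat.div_add_mod (2 ^ (n + M)) M
    have h' := Nat.mod_lt (2 ^ (n + M)) hM
    have : 2 ^ (n + M) ≤ M * (2 ^ (n + M) / M) + M := by omega
    have : (2 : ℝ) ^ (n + M) ≤ M * ((2 ^ (n + M) / M : ℕ) : ℝ) + M := by exact_mod_cast this
    linarith
  have hM1 : (M : ℝ) ≤ 2 ^ (n + M) := by exact_mod_cast (Nat.lt_two_pow_self.le.trans
    (Nat.pow_le_pow_right (by norm_num) (by omega : M ≤ n + M)))
  set x : ℝ := M / 2 ^ (n + M) with hx
  have hx1 : x ≤ 1 := by rw [hx, div_le_one hP]; exact hM1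
  have hb := one_add_mul_le_pow (show (-2 : ℝ) ≤ -x by linarith) n
  have hnx : n * x ≤ 1 / 2 := by
    rw [hx, ← mul_div_assoc, div_le_iff₀ hP]; linarith
  calc (1 / 2 : ℝ) ≤ 1 + n * (-x) := by linarith
    _ ≤ (1 + -x) ^ n := hb
    _ ≤ _ := by
      refine pow_le_pow_left₀ (by linarith) ?_ n
      rw [le_div_iff₀ hP]
      calc (1 + -x) * 2 ^ (n + M) = 2 ^ (n + M) - M := by rw [hx]; field_simp; ring
        _ ≤ _ := h4

end KMMD

/-! ### Amplification -/

namespace KMMD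

open Polynomial MeasureTheory

instance : IsProbabilityMeasure coinMeasure := by unfold coinMeasure; infer_instance

/-- Injectivity of `e` makes the constraints concern different coins, so the probabilities multiply.
-/
theorem coinMeasure_cylinder {ι : Type*} [Fintype ι] (e : ι → ℕ) (he : Function.Injective e)
    (x : ι → Bool) :
    MeasurableSet {ω : ℕ → Bool | ∀ i, ω (e i) = x i} ∧
      coinMeasure.real {ω : ℕ → Bool | ∀ i, ω (e i) = x i} = (1 / 2) ^ Fintype.card ι := by
  classical
  have hset : {ω : ℕ → Bool | ∀ i, ω (e i) = x i} =
      Set.pi (Finset.univ.image e : Finset ℕ) fun j => {b | ∀ i, e i = j → b = x i} := by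
    ext ω
    simp only [Set.mem_ofPred_eq, Set.mem_pi, Finset.coe_image, Finset.coe_univ, Set.image_univ,
      Set.mem_range, forall_exists_index, forall_apply_eq_imp_iff]
    exact ⟨fun h i j hj => by rw [h i, he hj], fun h i => h i i rfl⟩
  have hsingle : ∀ i, {b : Bool | ∀ i', e i' = e i → b = x i'} = {x i} := by
    intro i
    ext b
    exact ⟨fun h => h i rfl, fun h i' hi' => by rw [he hi']; exact h⟩
  refine ⟨?_, ?_⟩
  · rw [hset]
    exact MeasurableSet.pi (Finset.countable_toSet _) fun _ _ => Set.Finite.measurableSet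
      (Set.toFinite _)
  · rw [hset, Measure.real, coinMeasure, Measure.infinitePi_pi _ fun _ _ =>
      Set.Finite.measurableSet (Set.toFinite _), Finset.prod_image fun i _ j _ h => he h]
    simp only [hsingle]
    simp

/-- An event about finitely many coins is a finite disjoint union of cylinders, so its probability
is a count. -/
theorem coinMeasure_eq_card {ι : Type*} [Fintype ι] [DecidableEq ι] (e : ι → ℕ) (he : Function.Injective e)
    (P : (ι → Bool) → Prop) :
    coinMeasure.real {ω : ℕ → Bool | P fun i => ω (e i)} =
      (open Classical in Finset.univ.filter P).card / 2 ^ Fintype.card ι := by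
  classical
  have hset : {ω : ℕ → Bool | P fun i => ω (e i)} =
      ⋃ x ∈ Finset.univ.filter P, {ω : ℕ → Bool | ∀ i, ω (e i) = x i} := by
    ext ω
    simp only [Set.mem_ofPred_eq, Set.mem_iUnion, Finset.mem_filter, Finset.mem_univ, true_and,
      exists_prop]
    exact ⟨fun h => ⟨_, h, fun _ => rfl⟩, fun ⟨x, hx, h⟩ => by rwa [funext h]⟩
  rw [hset, measureReal_biUnion_finset]
  · rw [Finset.sum_congr rfl fun x _ => (coinMeasure_cylinder e he x).2, Finset.sum_const,
      nsmul_eq_mul, one_div, inv_pow, div_eq_mul_inv]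
  · intro x _ y _ hxy
    refine Set.disjoint_left.2 fun ω hx hy => hxy (funext fun i => ?_)
    rw [← hx i, ← hy i]
  · exact fun x _ => (coinMeasure_cylinder e he x).1

/-- Independent repetition. -/
theorem card_exists_ge {β : Type*} [Fintype β] [Nonempty β] (N : ℕ) (G : Finset β) (p : ℝ)
    (hp : p ≤ (G.card : ℝ) / Fintype.card β) (hN : 2 ≤ p * N) :
    2 / 3 * (Fintype.card β : ℝ) ^ N ≤
      (open Classical in Finset.univ.filter fun b : Fin N → β => ∃ τ, b τ ∈ G).card := by
  classical
  have hβ : (0 : ℝ) < Fintype.card β := by exact_mod_cast Fintype.card_pos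
  have h1 := Finset.card_filter_add_card_filter_not (s := (Finset.univ : Finset (Fin N → β)))
    (fun b => ∃ τ, b τ ∈ G)
  have h2 : (Finset.univ.filter fun b : Fin N → β => ¬ ∃ τ, b τ ∈ G) =
      Fintype.piFinset fun _ => Gᶜ := by
    ext b; simp
  rw [h2, Fintype.card_piFinset, Finset.prod_const, Finset.card_univ, Finset.card_univ,
    Fintype.card_fun, Fintype.card_fin] at h1
  have h3 : ((Gᶜ.card : ℕ) : ℝ) = Fintype.card β - G.card := by
    rw [Finset.card_compl, Nat.cast_sub (Finset.card_le_univ G)]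
  have h1' : ((Finset.univ.filter fun b : Fin N → β => ∃ τ, b τ ∈ G).card : ℝ) +
      (Fintype.card β - G.card : ℝ) ^ N = (Fintype.card β : ℝ) ^ N := by
    rw [← h3]; exact_mod_cast h1
  -- From 1 - p ≤ exp(-p); the `N`-th power is then at most exp(-pN) ≤ exp(-2) ≤ 1/3 of the total.
  have h4 : (Fintype.card β - G.card : ℝ) ≤ Fintype.card β * Real.exp (-p) := by
    have := Real.add_one_le_exp (-p)
    rw [le_div_iff₀ hβ] at hp
    calc (Fintype.card β - G.card : ℝ) ≤ Fintype.card β * (-p + 1) := by linarith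
      _ ≤ _ := by gcongr
  have h5 : (0 : ℝ) ≤ Fintype.card β - G.card := by rw [← h3]; positivity
  have h6 : (Fintype.card β - G.card : ℝ) ^ N ≤ (Fintype.card β : ℝ) ^ N * (1 / 3) := by
    refine (pow_le_pow_left₀ h5 h4 N).trans ?_
    rw [mul_pow, ← Real.exp_nat_mul]
    gcongr
    have h7 : Real.exp (N * -p) ≤ Real.exp (-2) := Real.exp_le_exp.2 (by linarith)
    have h8 : Real.exp (-2) ≤ 1 / 3 := by
      rw [Real.exp_neg, ← one_div]
      have : Real.exp 2 = Real.exp 1 * Real.exp 1 := by rw [← Real.exp_add]; norm_num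
      have h9 := Real.exp_one_gt_d9
      refine one_div_le_one_div_of_le (by norm_num) ?_
      rw [this]; nlinarith
    linarith
  linarith

section

variable {F : Type*} [Field F] {n : ℕ}

theorem trialHits_iff (k : ℕ) (f : MvPolynomial (Fin n) F) (ω : ℕ → Bool) (τ : ℕ) :
    TrialHits k f ω τ ↔ Good k f (residues (pairCount k) (pairCount_pos k)
      fun (i : Fin n) (j : Fin (bitCount n k)) =>
        ω (i * bitCount n k + j + τ * (n * bitCount n k))) := by
  refine Hit.congr (fun i => ?_) (fun i => ?_) <;>
    simp [extend_apply, drawnColour, drawnExponent, draw, residues, Finset.sum_range]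

/-- Three losses multiply: distinct colours, 1/2 from Schwartz–Zippel and 1/2 from the bias of the
residues, so 12 = 3 · 2 · 2. -/
theorem good_fraction_ge (k : ℕ) (f : MvPolynomial (Fin n) F) (h : HasMultilinearMonomial k f) :
    1 / (12 * blockCount k * 5.03 ^ blockCount k) ≤
      ((open Classical in Finset.univ.filter fun b : Fin n → Fin (bitCount n k) → Bool =>
        Good k f (residues (pairCount k) (pairCount_pos k) b)).card : ℝ) /
      Fintype.card (Fin n → Fin (bitCount n k) → Bool) := by
  classical
  obtain ⟨hkn, hg⟩ := card_good_ge k f h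
  set G := Finset.univ.filter fun v : Fin n → Fin (pairCount k) => Good k f v
  have hb := card_residues_ge (L := bitCount n k) (pairCount_pos k) G
  have hfilter : (Finset.univ.filter fun b : Fin n → Fin (bitCount n k) → Bool =>
      residues (pairCount k) (pairCount_pos k) b ∈ G) =
      Finset.univ.filter fun b : Fin n → Fin (bitCount n k) → Bool =>
        Good k f (residues (pairCount k) (pairCount_pos k) b) := by
    ext b; simp [G]
  rw [hfilter] at hb
  have hb' : (G.card : ℝ) * ((2 ^ bitCount n k / pairCount k : ℕ) : ℝ) ^ n ≤
      ((Finset.univ.filter fun b : Fin n → Fin (bitCount n k) → Bool =>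
        Good k f (residues (pairCount k) (pairCount_pos k) b)).card : ℝ) := by
    exact_mod_cast hb
  have hbias := half_le_bias_pow n (pairCount k) (pairCount_pos k)
  have hd := descFactorial_ge k
  have hcard : (Fintype.card (Fin n → Fin (bitCount n k) → Bool) : ℝ) =
      (2 ^ bitCount n k : ℝ) ^ n := by simp
  rw [hcard, le_div_iff₀ (by positivity)]
  refine le_trans ?_ hb'
  refine le_trans ?_ (mul_le_mul_of_nonneg_right hg (by positivity))
  have hm : (0 : ℝ) < colourCount k := by exact_mod_cast colourCount_pos k
  have hM : (pairCount k : ℝ) = colourCount k * exponentCount k := by simp [pairCount]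
  set t : ℝ := ((2 ^ bitCount n k / pairCount k : ℕ) : ℝ) with ht
  set P : ℝ := 2 ^ bitCount n k with hP
  have hP0 : 0 < P := by positivity
  have hbias' : 1 / 2 * P ^ n ≤ (pairCount k * t) ^ n := by
    have : 1 / 2 ≤ (pairCount k * t / P) ^ n := hbias
    rwa [div_pow, le_div_iff₀ (by positivity)] at this
  have hq : (0 : ℝ) < blockCount k := by exact_mod_cast blockCount_pos k
  calc 1 / (12 * (blockCount k : ℝ) * 5.03 ^ blockCount k) * P ^ n
      = 1 / (3 * (blockCount k : ℝ) * 5.03 ^ blockCount k) * (1 / 2) * (1 / 2 * P ^ n) := by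
        field_simp; ring
    _ ≤ ((colourCount k).descFactorial k : ℝ) / (colourCount k : ℝ) ^ k * (1 / 2) *
        (pairCount k * t) ^ n := by gcongr
    _ = _ := by
      have : (colourCount k : ℝ) ^ n = (colourCount k : ℝ) ^ (n - k) * (colourCount k : ℝ) ^ k := by
        rw [← pow_add, Nat.sub_add_cancel hkn]
      rw [hM, mul_pow, mul_pow, this]
      field_simp

/-- The position of a coin on the tape of random bits. -/
theorem coin_position_injective (N n L : ℕ) :
    Function.Injective fun p : Fin N × Fin n × Fin L =>
      (p.2.1 * L + p.2.2 + p.1 * (n * L) : ℕ) := by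
  rintro ⟨τ, i, j⟩ ⟨τ', i', j'⟩ h
  have hL : 0 < L := j.pos
  have hn : 0 < n := i.pos
  have hlt : ∀ (i : Fin n) (j : Fin L), (i * L + j : ℕ) < n * L := by
    intro i j
    have : ((i : ℕ) + 1) * L ≤ n * L := Nat.mul_le_mul_right _ i.2
    have := j.2
    rw [Nat.succ_mul] at *
    omega
  have h0 : 0 < n * L := Nat.mul_pos hn hL
  have hτ : (τ : ℕ) = τ' := by
    have := congrArg (· / (n * L)) h
    simpa [Nat.add_mul_div_right _ _ h0, Nat.div_eq_of_lt (hlt _ _)] using this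
  simp only [hτ] at h
  have h : (i * L + j : ℕ) = i' * L + j' := by omega
  have hi : (i : ℕ) = i' := by
    have := congrArg (· / L) h
    simpa [Nat.add_comm (_ * L), Nat.add_mul_div_right _ _ hL, Nat.div_eq_of_lt j.2,
      Nat.div_eq_of_lt j'.2] using this
  rw [hi] at h
  simp only [Prod.mk.injEq]
  exact ⟨Fin.ext hτ, Fin.ext hi, Fin.ext (by omega)⟩

theorem two_le_trialCount (k : ℕ) :
    2 ≤ 1 / (12 * (blockCount k : ℝ) * 5.03 ^ blockCount k) * trialCount k := by
  have hq : (0 : ℝ) < blockCount k := by exact_mod_cast blockCount_pos k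
  unfold trialCount
  set q := blockCount k
  have h1 : (5.03 : ℝ) ^ q ≤ ((503 ^ q / 100 ^ q : ℕ) : ℝ) + 1 := by
    have h := Nat.lt_mul_div_succ (503 ^ q) (show 0 < 100 ^ q by positivity)
    have : (503 : ℝ) ^ q < 100 ^ q * (((503 ^ q / 100 ^ q : ℕ) : ℝ) + 1) := by exact_mod_cast h
    have h2 : (5.03 : ℝ) ^ q = 503 ^ q / 100 ^ q := by rw [← div_pow]; norm_num
    rw [h2, div_le_iff₀ (by positivity), mul_comm]
    exact this.le
  rw [one_div, ← div_eq_inv_mul, le_div_iff₀ (by positivity)]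
  rw [Nat.cast_mul, Nat.cast_add, Nat.cast_mul]
  push_cast at h1 ⊢
  calc 2 * (12 * (q : ℝ) * 5.03 ^ q) = 24 * q * 5.03 ^ q := by ring
    _ ≤ _ := by gcongr

/-- The trials read different coins, so their joint outcome is a uniform point of a product and
`card_exists_ge` applies. -/
theorem two_thirds_le_prob (k : ℕ) (f : MvPolynomial (Fin n) F)
    (h : HasMultilinearMonomial k f) :
    2 / 3 ≤ coinMeasure.real {ω : ℕ → Bool | ∃ τ < trialCount k, TrialHits k f ω τ} := by
  classical
  set N := trialCount k
  set L := bitCount n k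
  have hset : {ω : ℕ → Bool | ∃ τ < N, TrialHits k f ω τ} =
      {ω : ℕ → Bool | (fun x : Fin N × Fin n × Fin L → Bool => ∃ τ : Fin N,
        Good k f (residues (pairCount k) (pairCount_pos k) fun i j => x (τ, i, j)))
        fun p => ω (p.2.1 * L + p.2.2 + p.1 * (n * L))} := by
    ext ω
    simp only [Set.mem_ofPred_eq, trialHits_iff]
    exact ⟨fun ⟨τ, hτ, h⟩ => ⟨⟨τ, hτ⟩, h⟩, fun ⟨τ, h⟩ => ⟨τ, τ.2, h⟩⟩
  rw [hset]
  refine le_of_le_of_eq ?_ (coinMeasure_eq_card _ (coin_position_injective N n L)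
    (fun x : Fin N × Fin n × Fin L → Bool => ∃ τ : Fin N,
        Good k f (residues (pairCount k) (pairCount_pos k) fun i j => x (τ, i, j)))).symm
  have hrep := card_exists_ge N (Finset.univ.filter fun b : Fin n → Fin L → Bool =>
    Good k f (residues (pairCount k) (pairCount_pos k) b)) _ (good_fraction_ge k f h)
    (two_le_trialCount k)
  rw [le_div_iff₀ (by positivity)]
  have hcard : ((2 : ℝ) ^ Fintype.card (Fin N × Fin n × Fin L)) =
      (Fintype.card (Fin n → Fin L → Bool) : ℝ) ^ N := by
    simp [← pow_mul]
    ring_nf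
  rw [hcard]
  refine hrep.trans_eq ?_
  norm_cast
  -- Currying matches the block of coins with one assignment of bits per trial.
  let e : (Fin N × Fin n × Fin L → Bool) ≃ (Fin N → Fin n → Fin L → Bool) :=
    (Equiv.curry _ _ _).trans (Equiv.arrowCongr (Equiv.refl _) (Equiv.curry _ _ _))
  refine (Finset.card_equiv e fun x => ?_).symm
  simp only [Finset.mem_filter, Finset.mem_univ, true_and]
  rfl

end

end KMMD

/-! ### Resource bounds -/

namespace KMMD

theorem blockCount_le {n k s : ℕ} (hs : 0 < s) : blockCount k ≤ n + k + s := by unfold blockCount; omega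

theorem bitCount_le {n k s : ℕ} (hs : 0 < s) : bitCount n k ≤ 25 * (n + k + s) ^ 2 := by
  have hq := blockCount_le (n := n) (k := k) hs
  have h1 : pairCount k ≤ 24 * (n + k + s) ^ 2 := by
    unfold pairCount colourCount exponentCount
    calc 4 * blockCount k * (6 * blockCount k) = 24 * blockCount k ^ 2 := by ring
      _ ≤ _ := by gcongr
  have h2 : n + k + s ≤ (n + k + s) ^ 2 := Nat.le_self_pow (by norm_num) _
  unfold bitCount
  omega

theorem shift_le {n k s : ℕ} (hs : 0 < s) : shift k ≤ 7 * (n + k + s) ^ 2 := by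
  have hq := blockCount_le (n := n) (k := k) hs
  have h1 : k * exponentCount k ≤ 6 * (n + k + s) ^ 2 := by
    unfold exponentCount
    calc k * (6 * blockCount k) ≤ (n + k + s) * (6 * (n + k + s)) := by gcongr; omega
      _ = _ := by ring
  have h2 : 1 ≤ (n + k + s) ^ 2 := Nat.one_le_pow _ _ (by omega)
  unfold shift
  omega

theorem truncation_le {n k s : ℕ} (hs : 0 < s) : truncation k ≤ 7 * (n + k + s) ^ 3 := by
  unfold truncation
  calc (k + 1) * shift k ≤ (n + k + s) * (7 * (n + k + s) ^ 2) :=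
        Nat.mul_le_mul (by omega) (shift_le hs)
    _ = _ := by ring

theorem size_mul_truncation_le {n k s : ℕ} (hs : 0 < s) : s * truncation k ≤ 7 * (n + k + s) ^ 4 := by
  calc s * truncation k ≤ (n + k + s) * (7 * (n + k + s) ^ 3) :=
        Nat.mul_le_mul (by omega) (truncation_le hs)
    _ = _ := by ring

theorem spaceNeed_le {n k s : ℕ} (hs : 0 < s) : spaceNeed n k s ≤ 77 * (n + k + s) ^ 4 := by
  have hq := blockCount_le (n := n) (k := k) hs
  have hL := bitCount_le (n := n) (k := k) hs
  have hD := size_mul_truncation_le (n := n) (k := k) hs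
  unfold spaceNeed colourCount
  set X := n + k + s
  have hX : 1 ≤ X := by omega
  have hp : ∀ i ≤ 4, X ^ i ≤ X ^ 4 := fun i hi => Nat.pow_le_pow_right hX hi
  have hm : (4 * blockCount k + 1) * (4 * blockCount k + 1) ≤ 25 * X ^ 2 := by
    calc _ ≤ (5 * X) * (5 * X) := by gcongr <;> omega
      _ = _ := by ring
  have h0 := hp 0 (by norm_num)
  have h1 := hp 1 (by norm_num)
  have h2 := hp 2 (by norm_num)
  rw [pow_zero] at h0
  rw [pow_one] at h1
  omega

theorem setTime_le {n k s : ℕ} (hs : 0 < s) : setTime k s ≤ 271 * (n + k + s) ^ 7 := by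
  have hq := blockCount_le (n := n) (k := k) hs
  have hE := shift_le (n := n) (k := k) hs
  have hD := truncation_le (n := n) (k := k) hs
  have hsD := size_mul_truncation_le (n := n) (k := k) hs
  unfold setTime colourCount
  set X := n + k + s
  have hX : 1 ≤ X := by omega
  have hp : ∀ i ≤ 7, X ^ i ≤ X ^ 7 := fun i hi => Nat.pow_le_pow_right hX hi
  have hm : s * truncation k * ((truncation k * 3 + 9) + 2) ≤ 147 * X ^ 7 + 77 * X ^ 4 := by
    calc _ ≤ (7 * X ^ 4) * ((7 * X ^ 3 * 3 + 9) + 2) := by gcongr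
      _ = _ := by ring
  have h0 := hp 0 (by norm_num)
  have h1 := hp 1 (by norm_num)
  have h2 := hp 2 (by norm_num)
  have h4 := hp 4 (by norm_num)
  rw [pow_zero] at h0
  rw [pow_one] at h1
  omega

theorem trialTime_le {n k s : ℕ} (hs : 0 < s) : trialTime n k s + 2 ≤ 2 ^ colourCount k * (439 * (n + k + s) ^ 7) := by
  have hL := bitCount_le (n := n) (k := k) hs
  have hE := shift_le (n := n) (k := k) hs
  have hT := setTime_le (n := n) (k := k) hs
  unfold trialTime
  set X := n + k + s with hXdef
  have hX : 1 ≤ X := by omega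
  have hp : ∀ i ≤ 7, X ^ i ≤ X ^ 7 := fun i hi => Nat.pow_le_pow_right hX hi
  have hm : n * ((bitCount n k * 4 + 5) + 2) ≤ 100 * X ^ 3 + 7 * X := by
    calc _ ≤ X * ((25 * X ^ 2 * 4 + 5) + 2) := by gcongr; omega
      _ = _ := by ring
  have h0 := hp 0 (by norm_num)
  have h1 := hp 1 (by norm_num)
  have h2 := hp 2 (by norm_num)
  have h3 := hp 3 (by norm_num)
  rw [pow_zero] at h0
  rw [pow_one] at h1
  have hP : 1 ≤ 2 ^ colourCount k := Nat.one_le_two_pow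
  have hY : 1 * (166 * X ^ 7) ≤ 2 ^ colourCount k * (166 * X ^ 7) := Nat.mul_le_mul_right _ hP
  have hZ : 2 ^ colourCount k * (setTime k s + 2) ≤ 2 ^ colourCount k * (273 * X ^ 7) :=
    Nat.mul_le_mul_left _ (by omega)
  have hsum : 2 ^ colourCount k * (439 * X ^ 7) =
      2 ^ colourCount k * (166 * X ^ 7) + 2 ^ colourCount k * (273 * X ^ 7) := by ring
  omega

/-- The base 4.32 arises here: trials times sets of colours give (5.03 · 16)^q = 80.48^q, while
4.32³ = 80.62…. -/
theorem trialCount_mul_le {n k s : ℕ} (hs : 0 < s) :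
    (trialCount k : ℝ) * 2 ^ colourCount k ≤ 3888 * ((n + k + s : ℕ) : ℝ) * 4.32 ^ k := by
  have hq : (blockCount k : ℝ) ≤ ((n + k + s : ℕ) : ℝ) := by
    exact_mod_cast blockCount_le (n := n) (k := k) hs
  unfold trialCount colourCount
  have h3 : 3 * blockCount k ≤ k + 3 := by unfold blockCount; omega
  set q := blockCount k
  have h1 : (((503 ^ q / 100 ^ q : ℕ) : ℝ)) ≤ 5.03 ^ q := by
    refine Nat.cast_div_le.trans_eq ?_
    push_cast
    rw [← div_pow]; norm_num
  have h2 : (1 : ℝ) ≤ 5.03 ^ q := one_le_pow₀ (by norm_num)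
  rw [Nat.cast_mul, Nat.cast_add, Nat.cast_mul]
  calc ((24 : ℕ) : ℝ) * q * (((503 ^ q / 100 ^ q : ℕ) : ℝ) + ((1 : ℕ) : ℝ)) * 2 ^ (4 * q)
      ≤ 24 * q * (5.03 ^ q + 5.03 ^ q) * 2 ^ (4 * q) := by push_cast at h1 ⊢; gcongr
    _ = 48 * q * 80.48 ^ q := by
        rw [pow_mul, ← two_mul, show (80.48 : ℝ) = 5.03 * 2 ^ 4 by norm_num, mul_pow]; ring
    _ ≤ 48 * q * (4.32 ^ 3) ^ q := by gcongr; norm_num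
    _ = 48 * q * 4.32 ^ (3 * q) := by rw [pow_mul]
    -- Rounding up to a multiple of three costs at most 4.32³, and 48 · 4.32³ < 3888.
    _ ≤ 48 * ((n + k + s : ℕ) : ℝ) * 4.32 ^ (k + 3) := by gcongr; norm_num
    _ = 48 * ((n + k + s : ℕ) : ℝ) * 4.32 ^ 3 * 4.32 ^ k := by rw [pow_add]; ring
    _ ≤ _ := by
      gcongr ?_ * _
      norm_num
      nlinarith [(Nat.cast_nonneg (n + k + s) : (0 : ℝ) ≤ ((n + k + s : ℕ) : ℝ))]

/-- Degree 7 comes from the schoolbook products in one evaluation, one more from the factor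
`blockCount k` in the number of trials. -/
theorem totalTime_le {n k s : ℕ} (hs : 0 < s) :
    (totalTime n k s : ℝ) ≤ 2000000 * ((n + k + s : ℕ) : ℝ) ^ 8 * 4.32 ^ k := by
  have hq := blockCount_le (n := n) (k := k) hs
  have hL := bitCount_le (n := n) (k := k) hs
  have hT := trialTime_le (n := n) (k := k) hs
  have hN := trialCount_mul_le (n := n) (k := k) hs
  have hpre : totalTime n k s ≤ 300 * (n + k + s) ^ 8 + trialCount k * (trialTime n k s + 2) := by
    unfold totalTime colourCount
    set X := n + k + s
    have hX : 1 ≤ X := by omega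
    have hp : ∀ i ≤ 8, X ^ i ≤ X ^ 8 := fun i hi => Nat.pow_le_pow_right hX hi
    have hm : (4 * blockCount k + 1) * (4 * blockCount k + 1) ≤ 25 * X ^ 2 := by
      calc _ ≤ (5 * X) * (5 * X) := by gcongr <;> omega
        _ = _ := by ring
    have h0 := hp 0 (by norm_num)
    have h1 := hp 1 (by norm_num)
    have h2 := hp 2 (by norm_num)
    rw [pow_zero] at h0
    rw [pow_one] at h1
    omega
  set X := n + k + s
  have hpre' : (totalTime n k s : ℝ) ≤
      300 * (X : ℝ) ^ 8 + trialCount k * ((trialTime n k s + 2 : ℕ) : ℝ) := by exact_mod_cast hpre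
  have hT' : ((trialTime n k s + 2 : ℕ) : ℝ) ≤ 2 ^ colourCount k * (439 * (X : ℝ) ^ 7) := by
    exact_mod_cast hT
  have h1 : (1 : ℝ) ≤ 4.32 ^ k := one_le_pow₀ (by norm_num)
  calc (totalTime n k s : ℝ)
      ≤ 300 * (X : ℝ) ^ 8 + trialCount k * (2 ^ colourCount k * (439 * (X : ℝ) ^ 7)) := by
        refine hpre'.trans ?_; gcongr
    _ = 300 * (X : ℝ) ^ 8 + (trialCount k * 2 ^ colourCount k) * (439 * (X : ℝ) ^ 7) := by ring
    _ ≤ 300 * (X : ℝ) ^ 8 * 4.32 ^ k + (3888 * X * 4.32 ^ k) * (439 * (X : ℝ) ^ 7) :=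
        add_le_add (le_mul_of_one_le_right (by positivity) h1) (by gcongr)
    _ = 1707132 * (X : ℝ) ^ 8 * 4.32 ^ k := by ring
    _ ≤ _ := by gcongr; norm_num

theorem outputs_detect {F : Type*} [Field F] {n : ℕ} (C : Circuit F n) (k : ℕ) {c : ℕ}
    (hc : 2000000 ≤ c) (ω : ℕ → Bool) :
    ∃ v, Flags v (∃ τ < trialCount k, TrialHits k C.poly ω τ) ∧
      Outputs Prog.detect (initState C k ω)
        (c * ((n + k + C.size : ℕ) : ℝ) ^ c * 4.32 ^ k) (c * (n + k + C.size) ^ c) v := by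
  have hs := C.size_pos
  have hX : 1 ≤ n + k + C.size := by omega
  have hspace : ∀ a ≤ 77, ∀ i ≤ 4, a * (n + k + C.size) ^ i ≤ c * (n + k + C.size) ^ c := by
    intro a ha i hi
    exact Nat.mul_le_mul (by omega) (Nat.pow_le_pow_right hX (by omega))
  have hfits : (initState C k ω).Fits (c * (n + k + C.size) ^ c) := by
    refine initState_fits C k ω (le_trans ?_ (hspace 4 (by omega) 1 (by omega)))
    rw [pow_one]; omega
  obtain ⟨σ', t, he, ht, hv⟩ := runs_detect C k ω hfits
    ((spaceNeed_le hs).trans (hspace 77 (by omega) 4 (by omega)))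
  refine ⟨σ'.reg 0, hv, hfits, σ', t, he, ?_, rfl⟩
  have h1 : (t : ℝ) ≤ totalTime n k C.size := by exact_mod_cast ht
  refine (h1.trans (totalTime_le hs)).trans ?_
  have hX' : (1 : ℝ) ≤ ((n + k + C.size : ℕ) : ℝ) := by exact_mod_cast hX
  have hc' : (2000000 : ℝ) ≤ c := by exact_mod_cast hc
  gcongr
  omega

end KMMD

/-! ### The main theorem -/

theorem theorem2 :
    ∃ (P : KMMD.Prog) (c : ℕ), ∀ (F : Type*) [Field F] (n k : ℕ) (C : KMMD.Circuit F n),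
      (∀ ω : ℕ → Bool, ∃ v ∈ ({0, 1} : Set ℕ),
        KMMD.Outputs P (KMMD.initState C k ω)
          (c * ((n + k + C.size : ℕ) : ℝ) ^ c * 4.32 ^ k) (c * (n + k + C.size) ^ c) v) ∧
      (KMMD.HasMultilinearMonomial k C.poly →
        2 / 3 ≤ KMMD.coinMeasure.real {ω : ℕ → Bool |
          KMMD.Outputs P (KMMD.initState C k ω)
            (c * ((n + k + C.size : ℕ) : ℝ) ^ c * 4.32 ^ k) (c * (n + k + C.size) ^ c) 1}) ∧
      (¬ KMMD.HasMultilinearMonomial k C.poly → ∀ ω : ℕ → Bool,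
        KMMD.Outputs P (KMMD.initState C k ω)
          (c * ((n + k + C.size : ℕ) : ℝ) ^ c * 4.32 ^ k) (c * (n + k + C.size) ^ c) 0) := by
  obtain ⟨c, hc⟩ : ∃ c : ℕ, 2000000 ≤ c := ⟨2000000, le_rfl⟩
  refine ⟨KMMD.Prog.detect, c, fun F _ n k C => ⟨fun ω => ?_, fun h => ?_, fun h ω => ?_⟩⟩
  · obtain ⟨v, hv, ho⟩ := KMMD.outputs_detect C k hc ω
    refine ⟨v, ?_, ho⟩
    rcases hv with ⟨-, hv⟩ | ⟨-, hv⟩ <;> simp [hv]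
  -- Whenever some trial hits, the answer is 1, so the success event contains the event already
  -- estimated.
  · refine (KMMD.two_thirds_le_prob k C.poly h).trans (MeasureTheory.measureReal_mono ?_)
    intro ω hω
    obtain ⟨v, hv, ho⟩ := KMMD.outputs_detect C k hc ω
    rcases hv with ⟨-, rfl⟩ | ⟨hn, -⟩
    · exact ho
    · exact absurd hω hn
  · obtain ⟨v, hv, ho⟩ := KMMD.outputs_detect C k hc ω
    rcases hv with ⟨⟨τ, -, ht⟩, -⟩ | ⟨-, rfl⟩
    · exact absurd ht.hasMultilinearMonomial h
    · exact ho
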